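/- Let $Y$ be a smooth $7$-manifold with a $G_2$ structure, i.e. a smooth positive $3$-form $\varphi$ with its induced metric $g=g_\varphi$. Let $\nabla$ be a smooth connection on $TY$ with $\nabla g=0$ and $\nabla\varphi=0$ whose torsion is totally antisymmetric and equal to a smooth $3$-form $H$, so that in local coordinates $\nabla_{\partial_a}\partial_b=\Gamma_{ab}{}^c\,\partial_c$ and $g_{ce}(\Gamma_{ab}{}^e-\Gamma_{ba}{}^e)=H_{abc}$. Let $\theta$ be the connection on $TY$ with connection one-forms $\theta_a{}^b=\Gamma_{ac}{}^b\,{\rm d}x^c$. Denote the curvatures of $\nabla$ and $\theta$ by $$R(\Gamma)_a{}^b=\tfrac12 (R(\Gamma)_a{}^b)_{cd}\,{\rm d}x^{cd}=(\partial_c\Gamma_{da}{}^b+\Gamma_{ce}{}^b\Gamma_{da}{}^e)\,{\rm d}x^{cd},\qquad R(\theta)_a{}^b={\rm d}\theta_a{}^b+\theta_c{}^b\wedge\theta_a{}^c ,$$ where ${\rm d}x^{cd}={\rm d}x^c\wedge{\rm d}x^d$, and lower the endomorphism index by $R_{ab}=g_{be}R_a{}^e$. For a two-form $\beta=\tfrac12\beta_{cd}\,{\rm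 d}x^{cd}$ put $\beta\lrcorner\varphi=\tfrac12\,\beta_{cd}\,\varphi^{cd}{}_e\,{\rm d}x^e$; a connection is called an instanton if its curvature $F$ satisfies $F\lrcorner\varphi=0$ (equivalently $F\wedge *\varphi=0$). 1. The curvatures satisfy $$(R(\Gamma)_{cd})_{ab}-(R(\theta)_{ab})_{cd}=\tfrac12\,({\rm d}H)_{abcd}.$$ 2. Let $V\to Y$ be a smooth real vector bundle of finite rank with a smooth instanton connection $A$ of curvature $F$, let $\tilde\theta$ be a smooth instanton connection on $TY$ with curvature $\tilde R$, let $\alpha'\in\mathbb R$, and suppose that the Bianchi identity of the anomaly cancellation condition holds: $${\rm d}H=\frac{\alpha'}{4}\,\big({\rm tr}(F\wedge F)-{\rm tr}(\tilde R\wedge\tilde R)\big).$$ Then $$R(\theta)_{ab}\,\lrcorner\,\varphi=\frac{\alpha'}{4}\,\big({\rm tr}(F_{ac}F_{bd})-{\rm tr}(\tilde R_{ac}\tilde R_{bd})\big)\,\varphi^{cd}{}_e\,{\rm d}x^e .$$ 3. Consequently $\theta$ is in general not an instanton: for every $\alpha'\neq 0$ there are data $(\varphi,H,\nabla,V,A,\tilde\theta)$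 as in 2, on $Y=\mathbb R^7$ with $V$ a trivial bundle, for which $R(\theta)\lrcorner\varphi\neq 0$. -/

import Mathlib

open Bundle
open scoped Manifold ContDiff

noncomputable section

namespace HetG2

/-- The model space `ℝ⁷`. -/
abbrev E7 : Type := EuclideanSpace ℝ (Fin 7)

/-- The form `e^{ijk}` on `ℝ⁷` evaluated on the standard basis vectors `e_a, e_b, e_c`. -/
def elem3 (i j k a b c : Fin 7) : ℝ :=
  Matrix.det (Matrix.of fun p q : Fin 3 => if ![i, j, k] p = ![a, b, c] q then (1 : ℝ) else 0)

/-- Components of the standard associative 3-form on `ℝ⁷`,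
`φ₀ = e¹²³ + e¹⁴⁵ + e¹⁶⁷ + e²⁴⁶ - e²⁵⁷ - e³⁴⁷ - e³⁵⁶` (indices shifted to `0, …, 6`).
It satisfies `6 g₀(x, y) vol₀ = (x ⌟ φ₀) ∧ (y ⌟ φ₀) ∧ φ₀`. -/
def phi0 (a b c : Fin 7) : ℝ :=
  elem3 0 1 2 a b c + elem3 0 3 4 a b c + elem3 0 5 6 a b c + elem3 1 3 5 a b c
    - elem3 1 4 6 a b c - elem3 2 3 6 a b c - elem3 2 4 5 a b c

section Coordinates

variable {Y : Type*} [TopologicalSpace Y] [ChartedSpace E7 Y]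

/-- Partial derivative `∂_a u` of a function on `Y` in the coordinates of the chart at `y₀`
(to be used at points `y` of the domain of that chart). -/
def pd (y₀ : Y) (a : Fin 7) (u : Y → ℝ) (y : Y) : ℝ :=
  fderiv ℝ (fun x : E7 => u ((chartAt E7 y₀).symm x)) (chartAt E7 y₀ y)
    (EuclideanSpace.single a (1 : ℝ))

/-- Curvature components `(R_a{}^b)_{cd}` of a connection on the tangent bundle with symbols
`Γ_{ca}{}^b = S c a b`, where `∇_c V^b = ∂_c V^b + Γ_{ca}{}^b V^a`; that is
`½ (R_a{}^b)_{cd} dx^c ∧ dx^d = (∂_c Γ_{da}{}^b + Γ_{ce}{}^b Γ_{da}{}^e) dx^c ∧ dx^d`. -/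
def curvature (y₀ : Y) (S : Fin 7 → Fin 7 → Fin 7 → Y → ℝ) (a b c d : Fin 7) (y : Y) : ℝ :=
  pd y₀ c (S d a b) y - pd y₀ d (S c a b) y
    + ∑ e, (S c e b y * S d a e y - S d e b y * S c a e y)

/-- Components of the exterior derivative of the 3-form with components `h a b c`. -/
def dThree (y₀ : Y) (h : Fin 7 → Fin 7 → Fin 7 → Y → ℝ) (a b c d : Fin 7) (y : Y) : ℝ :=
  pd y₀ a (h b c d) y - pd y₀ b (h a c d) y + pd y₀ c (h a b d) y - pd y₀ d (h a b c) y

variable [IsManifold (𝓡 7) ∞ Y]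

/-- The trivialization of the tangent bundle over the chart at `y₀`. -/
abbrev tangentTriv (y₀ : Y) :
    Trivialization E7 (TotalSpace.proj : TotalSpace E7 (TangentSpace (𝓡 7) : Y → Type) → Y) :=
  trivializationAt E7 (TangentSpace (𝓡 7) : Y → Type) y₀

/-- The coordinate vector field `∂/∂x^a` of the chart at `y₀` (zero outside its domain). -/
def coordField (y₀ : Y) (a : Fin 7) (y : Y) : TangentSpace (𝓡 7) y :=
  (tangentTriv y₀).localFrame (EuclideanSpace.basisFun (Fin 7) ℝ).toBasis a y

/-- Components of a trilinear alternating form in the chart at `y₀`. -/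
def comp3 (h : ∀ y : Y, TangentSpace (𝓡 7) y [⋀^Fin 3]→L[ℝ] ℝ) (y₀ : Y)
    (a b c : Fin 7) (y : Y) : ℝ :=
  h y ![coordField y₀ a y, coordField y₀ b y, coordField y₀ c y]

/-- Connection symbols of a connection on `TY` in the chart at `y₀`:
`∇_{∂_a} ∂_b = Γ_{ab}{}^c ∂_c` with `Γ_{ab}{}^c = symbols cov y₀ a b c`. -/
def symbols (cov : CovariantDerivative (𝓡 7) E7 (TangentSpace (𝓡 7) : Y → Type)) (y₀ : Y)
    (a b c : Fin 7) (y : Y) : ℝ :=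
  (tangentTriv y₀).localFrameCoeff (𝓡 7) (EuclideanSpace.basisFun (Fin 7) ℝ).toBasis c y
    (cov (coordField y₀ b) y (coordField y₀ a y))

/-- Symbols of the connection `θ` associated with `∇`: its connection one-forms are
`θ_a{}^b = Γ_{ac}{}^b dx^c`, so that the roles of the two lower indices are exchanged. -/
def thetaSymbols (cov : CovariantDerivative (𝓡 7) E7 (TangentSpace (𝓡 7) : Y → Type)) (y₀ : Y)
    (c a b : Fin 7) (y : Y) : ℝ :=
  symbols cov y₀ a c b y

variable (Y) in
/-- A smooth 3-form on `Y`. -/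
structure ThreeForm where
  form : ∀ y : Y, TangentSpace (𝓡 7) y [⋀^Fin 3]→L[ℝ] ℝ
  smooth : ∀ (y₀ : Y) (a b c : Fin 7),
    ContMDiffOn (𝓡 7) 𝓘(ℝ) ∞ (comp3 form y₀ a b c) (chartAt E7 y₀).source

variable (Y) in
/-- A `G₂` structure on `Y`: a smooth 3-form `φ` which at every point is identified with `φ₀` by
some basis of the tangent space, together with the metric `g_φ` it determines, for which every
such basis is orthonormal. -/
structure G2Structure where
  phi : ThreeForm Y
  g : ContMDiffRiemannianMetric (𝓡 7) ∞ E7 (TangentSpace (𝓡 7) : Y → Type)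
  adapted : ∀ y : Y, ∃ b : Module.Basis (Fin 7) ℝ (TangentSpace (𝓡 7) y),
    (∀ i j, g.inner y (b i) (b j) = if i = j then 1 else 0) ∧
    ∀ i j k, phi.form y ![b i, b j, b k] = phi0 i j k

namespace G2Structure

/-- Components `g_{ab}` of the metric in the chart at `y₀`. -/
def gComp (S : G2Structure Y) (y₀ : Y) (a b : Fin 7) (y : Y) : ℝ :=
  S.g.inner y (coordField y₀ a y) (coordField y₀ b y)

/-- Components `g^{ab}` of the inverse metric in the chart at `y₀`. -/
def gInv (S : G2Structure Y) (y₀ : Y) (a b : Fin 7) (y : Y) : ℝ :=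
  (Matrix.of fun p q => S.gComp y₀ p q y)⁻¹ a b

/-- Components `φ_{abc}` in the chart at `y₀`. -/
def phiComp (S : G2Structure Y) (y₀ : Y) (a b c : Fin 7) (y : Y) : ℝ :=
  comp3 S.phi.form y₀ a b c y

/-- Components `φ^{cd}{}_e` in the chart at `y₀`. -/
def phiUp (S : G2Structure Y) (y₀ : Y) (c d e : Fin 7) (y : Y) : ℝ :=
  ∑ p, ∑ q, S.gInv y₀ c p y * S.gInv y₀ d q y * S.phiComp y₀ p q e y

/-- The component `(β ⌟ φ)_e = ½ β_{cd} φ^{cd}{}_e` of the contraction of a two-form `β`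
with `φ`. -/
def contract (S : G2Structure Y) (y₀ : Y) (β : Fin 7 → Fin 7 → ℝ) (e : Fin 7) (y : Y) : ℝ :=
  (1 / 2) * ∑ c, ∑ d, β c d * S.phiUp y₀ c d e y

end G2Structure

/-- `(R(Γ)_{ab})_{cd}`, the curvature of `∇` with its endomorphism index lowered,
`R_{ab} = g_{be} R_a{}^e`. -/
def curvNabla (S : G2Structure Y)
    (cov : CovariantDerivative (𝓡 7) E7 (TangentSpace (𝓡 7) : Y → Type))
    (y₀ : Y) (a b c d : Fin 7) (y : Y) : ℝ :=
  ∑ e, S.gComp y₀ b e y * curvature y₀ (symbols cov y₀) a e c d y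

/-- `(R(θ)_{ab})_{cd}`, the curvature of the connection `θ` associated with `∇`, with its
endomorphism index lowered. -/
def curvTheta (S : G2Structure Y)
    (cov : CovariantDerivative (𝓡 7) E7 (TangentSpace (𝓡 7) : Y → Type))
    (y₀ : Y) (a b c d : Fin 7) (y : Y) : ℝ :=
  ∑ e, S.gComp y₀ b e y * curvature y₀ (thetaSymbols cov y₀) a e c d y

/-- `∇` is a smooth connection with `G₂` holonomy (`∇g = 0` and `∇φ = 0`) whose torsion
`T_{ab}{}^c = Γ_{ab}{}^c - Γ_{ba}{}^c` is totally antisymmetric and equal to `H`. -/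
structure IsSkewG2Connection (S : G2Structure Y) (H : ThreeForm Y)
    (cov : CovariantDerivative (𝓡 7) E7 (TangentSpace (𝓡 7) : Y → Type)) : Prop where
  smooth : cov.ContMDiffCovariantDerivative ∞
  metric : ∀ (y₀ y : Y), y ∈ (chartAt E7 y₀).source → ∀ a b c,
    pd y₀ a (S.gComp y₀ b c) y
      - ∑ e, symbols cov y₀ a b e y * S.gComp y₀ e c y
      - ∑ e, symbols cov y₀ a c e y * S.gComp y₀ b e y = 0
  parallel : ∀ (y₀ y : Y), y ∈ (chartAt E7 y₀).source → ∀ a b c d,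
    pd y₀ a (S.phiComp y₀ b c d) y
      - ∑ e, symbols cov y₀ a b e y * S.phiComp y₀ e c d y
      - ∑ e, symbols cov y₀ a c e y * S.phiComp y₀ b e d y
      - ∑ e, symbols cov y₀ a d e y * S.phiComp y₀ b c e y = 0
  torsion : ∀ (y₀ y : Y), y ∈ (chartAt E7 y₀).source → ∀ a b c,
    ∑ e, S.gComp y₀ c e y * (symbols cov y₀ a b e y - symbols cov y₀ b a e y)
      = comp3 H.form y₀ a b c y

/-- The connection `θ` associated with `∇` is an instanton: `R(θ) ⌟ φ = 0`. -/
def ThetaIsInstanton (S : G2Structure Y)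
    (cov : CovariantDerivative (𝓡 7) E7 (TangentSpace (𝓡 7) : Y → Type)) : Prop :=
  ∀ (y₀ y : Y), y ∈ (chartAt E7 y₀).source → ∀ a b e,
    S.contract y₀ (fun c d => curvTheta S cov y₀ a b c d y) e y = 0

section Gauge

variable {F : Type*} [NormedAddCommGroup F] [NormedSpace ℝ F] [FiniteDimensional ℝ F]
  {V : Y → Type*} [TopologicalSpace (TotalSpace F V)]
  [∀ y, AddCommGroup (V y)] [∀ y, Module ℝ (V y)] [∀ y, TopologicalSpace (V y)]
  [∀ y, IsTopologicalAddGroup (V y)] [∀ y, ContinuousSMul ℝ (V y)]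
  [FiberBundle F V] [VectorBundle ℝ F V] [ContMDiffVectorBundle ∞ F V (𝓡 7)]

variable (F V) in
/-- The local frame `s_j` of `V` given by the trivialization at `y₀` (zero outside its domain). -/
def frame (y₀ : Y) (j : Fin (Module.finrank ℝ F)) (y : Y) : V y :=
  (trivializationAt F V y₀).localFrame (Module.finBasis ℝ F) j y

variable (F V) in
/-- The open set around `y₀` on which both the chart and the trivialization of `V` at `y₀` are
defined. -/
def patch (y₀ : Y) : Set Y :=
  (chartAt E7 y₀).source ∩ (trivializationAt F V y₀).baseSet

/-- The matrix entry `(A_a)^i{}_j` of the local connection form: `∇_{∂_a} s_j = (A_a)^i{}_j s_i`. -/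
def gaugeField (A : CovariantDerivative (𝓡 7) F V) (y₀ : Y)
    (a : Fin 7) (i j : Fin (Module.finrank ℝ F)) (y : Y) : ℝ :=
  (trivializationAt F V y₀).localFrameCoeff (𝓡 7) (Module.finBasis ℝ F) i y
    (A (frame F V y₀ j) y (coordField y₀ a y))

/-- The component `F_{ab} = ∂_a A_b - ∂_b A_a + A_a A_b - A_b A_a` of the curvature
`F = dA + A ∧ A = ½ F_{ab} dx^a ∧ dx^b`, a matrix in the local frame. -/
def gaugeCurv (A : CovariantDerivative (𝓡 7) F V) (y₀ : Y)
    (a b : Fin 7) (y : Y) :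
    Matrix (Fin (Module.finrank ℝ F)) (Fin (Module.finrank ℝ F)) ℝ :=
  Matrix.of fun i j =>
    pd y₀ a (gaugeField A y₀ b i j) y - pd y₀ b (gaugeField A y₀ a i j) y
      + ∑ k, (gaugeField A y₀ a i k y * gaugeField A y₀ b k j y
          - gaugeField A y₀ b i k y * gaugeField A y₀ a k j y)

/-- `tr (F_{ab} F_{cd})`. -/
def trFF (A : CovariantDerivative (𝓡 7) F V) (y₀ : Y)
    (a b c d : Fin 7) (y : Y) : ℝ :=
  Matrix.trace (gaugeCurv A y₀ a b y * gaugeCurv A y₀ c d y)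

/-- The component `(tr (F ∧ F))_{abcd}`, by the shuffle formula for the wedge product of two
two-forms. -/
def trFwedgeF (A : CovariantDerivative (𝓡 7) F V) (y₀ : Y)
    (a b c d : Fin 7) (y : Y) : ℝ :=
  trFF A y₀ a b c d y - trFF A y₀ a c b d y + trFF A y₀ a d b c y
    + trFF A y₀ b c a d y - trFF A y₀ b d a c y + trFF A y₀ c d a b y

/-- `A` is an instanton: its curvature satisfies `F ⌟ φ = 0`, that is `F ∈ Λ²₁₄(Y, End V)`
(equivalently `F ∧ ψ = 0` with `ψ = *φ`). -/
def IsInstanton (S : G2Structure Y)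
    (A : CovariantDerivative (𝓡 7) F V) : Prop :=
  ∀ (y₀ y : Y), y ∈ patch F V y₀ → ∀ i j e,
    S.contract y₀ (fun c d => gaugeCurv A y₀ c d y i j) e y = 0

/-- A heterotic `G₂` system: a `G₂` structure with a connection `∇` of `G₂` holonomy and totally
antisymmetric torsion `H`, instanton connections `A` on `V` and `θt` on `TY`, and the Bianchi
identity `dH = (α'/4) (tr (F ∧ F) - tr (R̃ ∧ R̃))` of the anomaly cancellation condition. -/
structure IsHeteroticG2System (α' : ℝ) (S : G2Structure Y)
    (H : ThreeForm Y) (cov : CovariantDerivative (𝓡 7) E7 (TangentSpace (𝓡 7) : Y → Type))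
    (A : CovariantDerivative (𝓡 7) F V)
    (θt : CovariantDerivative (𝓡 7) E7 (TangentSpace (𝓡 7) : Y → Type)) : Prop where
  connection : IsSkewG2Connection S H cov
  smooth_gauge : A.ContMDiffCovariantDerivative ∞
  smooth_tangent : θt.ContMDiffCovariantDerivative ∞
  instanton_gauge : IsInstanton S A
  instanton_tangent : IsInstanton S θt
  bianchi : ∀ (y₀ y : Y), y ∈ patch F V y₀ → ∀ a b c d,
    dThree y₀ (comp3 H.form y₀) a b c d y
      = α' / 4 * (trFwedgeF A y₀ a b c d y - trFwedgeF θt y₀ a b c d y)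

end Gauge

end Coordinates

end HetG2

end

/-! Everything is reduced to tensor calculus in one chart. Write L_abc = g_ce Γ_ab^e. Metricity and
skew torsion give the Koszul formula L_abc = ½(∂_a g_bc + ∂_b g_ac - ∂_c g_ab + H_abc)
(`lowered_eq_koszul`). The transposed symbols defining θ have torsion -H and are again metric. For
any metric connection the lowered curvature is a difference of derivatives of L plus scalar products
of covariant derivatives of coordinate fields (`sum_mul_localCurvature`). After exchanging the index
pairs the quadratic terms for ∇ and θ coincide. The difference is therefore linear in ∂L; second
derivatives of g cancel and ½ dH remains (`localCurvature_sub_transposed`).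

For the contraction with φ, differentiating ∇φ = 0 twice shows that the curvature of ∇ annihilates φ
(`slotAction_localCurvature`). Together with skewness this puts its endomorphism indices in the Lie
algebra of G₂, which is killed by contraction with φ (`sum_mul_contract_eq_zero`). By the pair
exchange these are the form indices of R(θ), so R(θ) ⌟ φ is -¼ dH_abcd φ^cd_e. In the Bianchi
identity the terms tr(F_ab F_cd) drop out because F is an instanton, and the mixed terms add up to
-4 tr(F_ac F_bd) φ^cd_e (`IsInstanton.sum_trFwedgeF_mul_phiUp`).

The counterexample is a Heisenberg-type geometry on ℝ⁷: η = dx⁰ + α with f = dη = dx³⁴ - dx⁵⁶, the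
forms φ and g standard in the coframe η, dx¹, …, dx⁶, and H = η ∧ f. In the dual frame the
connection form of ∇ is η ⊗ f, and f lies in the Lie algebra of G₂ (`slotAction_heisF`), so g and φ
are parallel. The same f gives the gauge instanton α ⊗ M on a trivial plane bundle, where M² is a
multiple of the identity chosen to match dH = f ∧ f; the second instanton is flat. The contraction
formula then gives a component of R(θ) ⌟ φ at the origin equal to 1. -/

namespace HetG2

/-! ### Matrices acting on three-index tensors -/

section SlotActions

variable {n : Type*} [Fintype n]

/-- The action of a matrix on the first slot of a three-index object. -/
def slot1 (M : Matrix n n ℝ) (t : n → n → n → ℝ) : n → n → n → ℝ :=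
  fun a b c => ∑ e, M a e * t e b c

/-- The action of a matrix on the second slot of a three-index object. -/
def slot2 (M : Matrix n n ℝ) (t : n → n → n → ℝ) : n → n → n → ℝ :=
  fun a b c => ∑ e, M b e * t a e c

/-- The action of a matrix on the third slot of a three-index object. -/
def slot3 (M : Matrix n n ℝ) (t : n → n → n → ℝ) : n → n → n → ℝ :=
  fun a b c => ∑ e, M c e * t a b e

/-- The derivation of three-index objects determined by a matrix. -/
def slotAction (M : Matrix n n ℝ) (t : n → n → n → ℝ) : n → n → n → ℝ :=
  slot1 M t + slot2 M t + slot3 M t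

theorem slotAction_apply (M : Matrix n n ℝ) (t : n → n → n → ℝ) (a b c : n) :
    slotAction M t a b c
      = ∑ e, M a e * t e b c + ∑ e, M b e * t a e c + ∑ e, M c e * t a b e :=
  rfl

theorem slot1_add (M : Matrix n n ℝ) (t u) : slot1 M (t + u) = slot1 M t + slot1 M u := by
  ext a b c; simp [slot1, mul_add, Finset.sum_add_distrib]

theorem slot2_add (M : Matrix n n ℝ) (t u) : slot2 M (t + u) = slot2 M t + slot2 M u := by
  ext a b c; simp [slot2, mul_add, Finset.sum_add_distrib]

theorem slot3_add (M : Matrix n n ℝ) (t u) : slot3 M (t + u) = slot3 M t + slot3 M u := by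
  ext a b c; simp [slot3, mul_add, Finset.sum_add_distrib]

theorem slot1_slot1 (M N : Matrix n n ℝ) (t) : slot1 M (slot1 N t) = slot1 (M * N) t := by
  ext a b c
  simp only [slot1, Matrix.mul_apply, Finset.mul_sum, Finset.sum_mul, mul_assoc]
  exact Finset.sum_comm

theorem slot2_slot2 (M N : Matrix n n ℝ) (t) : slot2 M (slot2 N t) = slot2 (M * N) t := by
  ext a b c
  simp only [slot2, Matrix.mul_apply, Finset.mul_sum, Finset.sum_mul, mul_assoc]
  exact Finset.sum_comm

theorem slot3_slot3 (M N : Matrix n n ℝ) (t) : slot3 M (slot3 N t) = slot3 (M * N) t := by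
  ext a b c
  simp only [slot3, Matrix.mul_apply, Finset.mul_sum, Finset.sum_mul, mul_assoc]
  exact Finset.sum_comm

theorem slot2_slot1 (M N : Matrix n n ℝ) (t) : slot2 M (slot1 N t) = slot1 N (slot2 M t) := by
  ext a b c
  simp only [slot1, slot2, Finset.mul_sum, mul_left_comm]
  exact Finset.sum_comm

theorem slot3_slot1 (M N : Matrix n n ℝ) (t) : slot3 M (slot1 N t) = slot1 N (slot3 M t) := by
  ext a b c
  simp only [slot1, slot3, Finset.mul_sum, mul_left_comm]
  exact Finset.sum_comm

theorem slot3_slot2 (M N : Matrix n n ℝ) (t) : slot3 M (slot2 N t) = slot2 N (slot3 M t) := by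
  ext a b c
  simp only [slot2, slot3, Finset.mul_sum, mul_left_comm]
  exact Finset.sum_comm

/-- Actions in different slots commute, so the mixed terms cancel and only products within one slot
survive. This representation property turns a commutator of covariant derivatives into the action of
the curvature. -/
theorem slotAction_commutator (M N : Matrix n n ℝ) (t) :
    slotAction M (slotAction N t) - slotAction N (slotAction M t)
      = slotAction (M * N - N * M) t := by
  have h1 : slot1 (M * N - N * M) t = slot1 (M * N) t - slot1 (N * M) t := by
    ext a b c; simp [slot1, sub_mul, Finset.sum_sub_distrib]
  have h2 : slot2 (M * N - N * M) t = slot2 (M * N) t - slot2 (N * M) t := by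
    ext a b c; simp [slot2, sub_mul, Finset.sum_sub_distrib]
  have h3 : slot3 (M * N - N * M) t = slot3 (M * N) t - slot3 (N * M) t := by
    ext a b c; simp [slot3, sub_mul, Finset.sum_sub_distrib]
  simp only [slotAction, slot1_add, slot2_add, slot3_add, slot1_slot1, slot2_slot2, slot3_slot3,
    slot2_slot1, slot3_slot1, slot3_slot2, h1, h2, h3]
  abel

theorem slot1_one [DecidableEq n] (t : n → n → n → ℝ) : slot1 1 t = t := by
  ext a b c; simp [slot1, Matrix.one_apply]

theorem slot2_one [DecidableEq n] (t : n → n → n → ℝ) : slot2 1 t = t := by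
  ext a b c; simp [slot2, Matrix.one_apply]

theorem slot3_one [DecidableEq n] (t : n → n → n → ℝ) : slot3 1 t = t := by
  ext a b c; simp [slot3, Matrix.one_apply]

/-- The derivation action is natural under a change of basis. -/
theorem slotAction_conj [DecidableEq n] {P Q : Matrix n n ℝ} (hQP : Q * P = 1) (R : Matrix n n ℝ)
    (t : n → n → n → ℝ) :
    slot1 Q (slot2 Q (slot3 Q (slotAction R (slot1 P (slot2 P (slot3 P t))))))
      = slotAction (Q * R * P) t := by
  simp only [slotAction, slot1_add, slot2_add, slot3_add, slot2_slot1, slot3_slot1, slot3_slot2,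
    slot1_slot1, slot2_slot2, slot3_slot3, hQP, slot1_one, slot2_one, slot3_one, ← mul_assoc]

/-- Contraction of a two-index object with the first two slots, after the slots were acted on. -/
theorem sum_mul_slot1_slot2 (w A B : Matrix n n ℝ) (t : n → n → n → ℝ) (k : n) :
    ∑ c, ∑ d, w c d * slot1 A (slot2 B t) c d k
      = ∑ i, ∑ j, (A.transpose * w * B) i j * t i j k := by
  have h : ∀ c d, w c d * slot1 A (slot2 B t) c d k
      = ∑ i, ∑ j, A c i * w c d * B d j * t i j k := fun c d => by
    simp only [slot1, slot2, Finset.mul_sum]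
    exact Finset.sum_congr rfl fun i _ => Finset.sum_congr rfl fun j _ => by ring
  have h' : ∀ i j, (A.transpose * w * B) i j * t i j k
      = ∑ d, ∑ c, A c i * w c d * B d j * t i j k := fun i j => by
    simp only [Matrix.mul_apply, Matrix.transpose_apply, Finset.sum_mul]
  simp only [h, h']
  calc ∑ c, ∑ d, ∑ i, ∑ j, A c i * w c d * B d j * t i j k
      = ∑ d, ∑ c, ∑ i, ∑ j, A c i * w c d * B d j * t i j k := Finset.sum_comm
    _ = ∑ d, ∑ i, ∑ c, ∑ j, A c i * w c d * B d j * t i j k :=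
        Finset.sum_congr rfl fun _ _ => Finset.sum_comm
    _ = ∑ i, ∑ d, ∑ c, ∑ j, A c i * w c d * B d j * t i j k := Finset.sum_comm
    _ = ∑ i, ∑ d, ∑ j, ∑ c, A c i * w c d * B d j * t i j k :=
        Finset.sum_congr rfl fun _ _ => Finset.sum_congr rfl fun _ _ => Finset.sum_comm
    _ = ∑ i, ∑ j, ∑ d, ∑ c, A c i * w c d * B d j * t i j k :=
        Finset.sum_congr rfl fun _ _ => Finset.sum_comm

end SlotActions

/-! ### The standard form `phi0` and its stabilizer algebra -/

section StandardForm

theorem elem3_eq (i j k a b c : Fin 7) :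
    elem3 i j k a b c =
      (if i = a then 1 else 0) * (if j = b then 1 else 0) * (if k = c then 1 else 0)
      - (if i = a then 1 else 0) * (if j = c then 1 else 0) * (if k = b then 1 else 0)
      - (if i = b then 1 else 0) * (if j = a then 1 else 0) * (if k = c then 1 else 0)
      + (if i = b then 1 else 0) * (if j = c then 1 else 0) * (if k = a then 1 else 0)
      + (if i = c then 1 else 0) * (if j = a then 1 else 0) * (if k = b then 1 else 0)
      - (if i = c then 1 else 0) * (if j = b then 1 else 0) * (if k = a then 1 else 0) := by
  rw [elem3, Matrix.det_fin_three]
  rfl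

theorem phi0_swap (a b c : Fin 7) : phi0 a b c = -phi0 b a c := by
  simp only [phi0, elem3_eq]
  ring

theorem phi0_rotate (a b c : Fin 7) : phi0 a b c = phi0 c a b := by
  simp only [phi0, elem3_eq]
  ring

/-- Expansion of the determinant along the contracted index leaves three terms, so explicit
components of contractions with `phi0` become short sums. -/
theorem sum_mul_elem3 (f : Fin 7 → ℝ) (i j k b c : Fin 7) :
    ∑ l, f l * elem3 i j k l b c =
      f i * ((if j = b ∧ k = c then 1 else 0) - (if j = c ∧ k = b then 1 else 0))
      + f j * ((if i = c ∧ k = b then 1 else 0) - (if i = b ∧ k = c then 1 else 0))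
      + f k * ((if i = b ∧ j = c then 1 else 0) - (if i = c ∧ j = b then 1 else 0)) := by
  have h : ∀ l, f l * elem3 i j k l b c =
      (if i = l then f l else 0)
          * ((if j = b ∧ k = c then 1 else 0) - (if j = c ∧ k = b then 1 else 0))
      + (if j = l then f l else 0)
          * ((if i = c ∧ k = b then 1 else 0) - (if i = b ∧ k = c then 1 else 0))
      + (if k = l then f l else 0)
          * ((if i = b ∧ j = c then 1 else 0) - (if i = c ∧ j = b then 1 else 0)) := fun l => by
    simp only [elem3_eq, ite_and]
    split_ifs <;> ring
  simp only [h, Finset.sum_add_distrib, ← Finset.sum_mul, Finset.sum_ite_eq, Finset.mem_univ,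
    if_true]

theorem sum_mul_phi0 (f : Fin 7 → ℝ) (b c : Fin 7) :
    ∑ l, f l * phi0 l b c =
      ∑ l, f l * elem3 0 1 2 l b c + ∑ l, f l * elem3 0 3 4 l b c
      + ∑ l, f l * elem3 0 5 6 l b c + ∑ l, f l * elem3 1 3 5 l b c
      - ∑ l, f l * elem3 1 4 6 l b c - ∑ l, f l * elem3 2 3 6 l b c
      - ∑ l, f l * elem3 2 4 5 l b c := by
  simp only [phi0, mul_add, mul_sub, Finset.sum_add_distrib, Finset.sum_sub_distrib]

/-- The total antisymmetry of `phi0` moves every contracted index to the first slot, where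
`sum_mul_phi0` and `sum_mul_elem3` apply. -/
theorem slotAction_phi0 (m : Matrix (Fin 7) (Fin 7) ℝ) (a b c : Fin 7) :
    slotAction m phi0 a b c
      = ∑ l, m a l * phi0 l b c - ∑ l, m b l * phi0 l a c + ∑ l, m c l * phi0 l a b := by
  simp only [slotAction, slot1, slot2, slot3, Pi.add_apply, phi0_swap a _ c, phi0_rotate a b _,
    mul_neg, Finset.sum_neg_distrib, sub_eq_add_neg]

/-- A skew matrix annihilating the standard 3-form has vanishing contraction with it. -/
theorem sum_mul_phi0_eq_zero {m : Matrix (Fin 7) (Fin 7) ℝ} (hm : ∀ i j, m i j = -m j i)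
    (h : slotAction m phi0 = 0) (k : Fin 7) : ∑ i, ∑ j, m i j * phi0 i j k = 0 := by
  have H : ∀ a b c : Fin 7, ∑ l, m a l * phi0 l b c - ∑ l, m b l * phi0 l a c
      + ∑ l, m c l * phi0 l a b = 0 := fun a b c => by
    rw [← slotAction_phi0, h]; rfl
  have hs : ∑ i, ∑ j, m i j * phi0 i j k = ∑ i, ∑ j, m i j * phi0 j k i :=
    Finset.sum_congr rfl fun i _ => Finset.sum_congr rfl fun j _ => by
      rw [phi0_rotate j k i]
  have hk : k = 0 ∨ k = 1 ∨ k = 2 ∨ k = 3 ∨ k = 4 ∨ k = 5 ∨ k = 6 := by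
    clear hs H hm h
    revert k
    decide
  rw [hs]
  clear hs h
  simp only [sum_mul_phi0, sum_mul_elem3]
  -- For each k the contraction is twice a signed sum of three entries of m, and a single component
  -- of the action on `phi0` equals that sum up to sign. For k = 0 the sum is m₁₂ + m₃₄ + m₅₆, found
  -- in component (1, 3, 6); the other triples are chosen in the same way.
  rcases hk with rfl | rfl | rfl | rfl | rfl | rfl | rfl
  · have := H 1 3 6
    simp [sum_mul_phi0, sum_mul_elem3] at this
    simp [Finset.sum_add_distrib]
    linarith [hm 1 2, hm 3 4, hm 5 6]
  · have := H 0 3 6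
    simp [sum_mul_phi0, sum_mul_elem3] at this
    simp [Finset.sum_add_distrib, Finset.sum_sub_distrib]
    linarith [hm 0 2, hm 3 5, hm 4 6]
  · have := H 0 3 5
    simp [sum_mul_phi0, sum_mul_elem3] at this
    simp [Finset.sum_add_distrib, Finset.sum_sub_distrib]
    linarith [hm 0 1, hm 3 6, hm 4 5]
  · have := H 0 1 6
    simp [sum_mul_phi0, sum_mul_elem3] at this
    simp [Finset.sum_add_distrib, Finset.sum_sub_distrib]
    linarith [hm 0 4, hm 1 5, hm 2 6]
  · have := H 0 1 5
    simp [sum_mul_phi0, sum_mul_elem3] at this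
    simp [Finset.sum_add_distrib, Finset.sum_sub_distrib]
    linarith [hm 0 3, hm 1 6, hm 2 5]
  · have := H 0 1 4
    simp [sum_mul_phi0, sum_mul_elem3] at this
    simp [Finset.sum_add_distrib, Finset.sum_sub_distrib]
    linarith [hm 0 6, hm 1 3, hm 2 4]
  · have := H 0 1 3
    simp [sum_mul_phi0, sum_mul_elem3] at this
    simp [Finset.sum_add_distrib, Finset.sum_sub_distrib]
    linarith [hm 0 5, hm 1 4, hm 2 3]

/-- Contraction of a two-form with a form adapted to `φ₀` by the basis change `P`. -/
theorem sum_mul_contract {P g : Matrix (Fin 7) (Fin 7) ℝ} {φ : Fin 7 → Fin 7 → Fin 7 → ℝ}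
    (hP : IsUnit P.det) (hg : g = P * P.transpose)
    (hφ : φ = slot1 P (slot2 P (slot3 P phi0))) (w : Matrix (Fin 7) (Fin 7) ℝ) (k : Fin 7) :
    ∑ c, ∑ d, w c d * slot1 g⁻¹ (slot2 g⁻¹ φ) c d k
      = ∑ e, P k e * ∑ i, ∑ j, (P⁻¹ * w * P⁻¹.transpose) i j * phi0 i j e := by
  -- Raising an index replaces P by its inverse transpose, which can then be moved onto w.
  have hgP : g⁻¹ * P = P⁻¹.transpose := by
    rw [hg, Matrix.mul_inv_rev, mul_assoc, Matrix.nonsing_inv_mul _ hP, mul_one,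
      Matrix.transpose_nonsing_inv]
  have key : slot1 g⁻¹ (slot2 g⁻¹ φ)
      = slot1 P⁻¹.transpose (slot2 P⁻¹.transpose (slot3 P phi0)) := by
    rw [hφ, slot2_slot1, slot1_slot1, slot2_slot2, hgP]
  rw [key, sum_mul_slot1_slot2, Matrix.transpose_transpose]
  calc ∑ i, ∑ j, (P⁻¹ * w * P⁻¹.transpose) i j * slot3 P phi0 i j k
      = ∑ i, ∑ j, ∑ e, P k e * ((P⁻¹ * w * P⁻¹.transpose) i j * phi0 i j e) := by
        simp only [slot3, Finset.mul_sum, mul_left_comm]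
    _ = ∑ i, ∑ e, ∑ j, P k e * ((P⁻¹ * w * P⁻¹.transpose) i j * phi0 i j e) :=
        Finset.sum_congr rfl fun _ _ => Finset.sum_comm
    _ = ∑ e, ∑ i, ∑ j, P k e * ((P⁻¹ * w * P⁻¹.transpose) i j * phi0 i j e) := Finset.sum_comm
    _ = _ := by simp only [Finset.mul_sum]

/-- A matrix in the stabilizer algebra of a form adapted to `φ₀` by the basis change `P` has
vanishing contraction with that form. -/
theorem sum_mul_contract_eq_zero {P g R : Matrix (Fin 7) (Fin 7) ℝ}
    {φ : Fin 7 → Fin 7 → Fin 7 → ℝ} (hP : IsUnit P.det) (hg : g = P * P.transpose)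
    (hφ : φ = slot1 P (slot2 P (slot3 P phi0)))
    (hw : ∀ i j, (R * g) i j = -(R * g) j i) (hR : slotAction R φ = 0) (k : Fin 7) :
    ∑ c, ∑ d, (R * g) c d * slot1 g⁻¹ (slot2 g⁻¹ φ) c d k = 0 := by
  have hQP : P⁻¹ * P = 1 := Matrix.nonsing_inv_mul _ hP
  have hPT : IsUnit P.transpose.det := by rwa [Matrix.det_transpose]
  have hm : slotAction (P⁻¹ * R * P) phi0 = 0 := by
    rw [← slotAction_conj hQP, ← hφ, hR]
    ext a b c
    simp [slot1, slot2, slot3]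
  -- In the adapted orthonormal basis the two-form and the endomorphism have the same matrix, so
  -- skewness and annihilation of `phi0` concern one object.
  have hRg : P⁻¹ * (R * g) * P⁻¹.transpose = P⁻¹ * R * P := by
    rw [hg, Matrix.transpose_nonsing_inv]
    calc P⁻¹ * (R * (P * P.transpose)) * P.transpose⁻¹
        = P⁻¹ * R * P * (P.transpose * P.transpose⁻¹) := by simp only [mul_assoc]
      _ = _ := by rw [Matrix.mul_nonsing_inv _ hPT, mul_one]
  have hskew : ∀ i j, (P⁻¹ * R * P) i j = -(P⁻¹ * R * P) j i := fun i j => by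
    have : (P⁻¹ * (R * g) * P⁻¹.transpose).transpose = -(P⁻¹ * (R * g) * P⁻¹.transpose) := by
      have hT : (R * g).transpose = -(R * g) := by
        ext i j
        rw [Matrix.transpose_apply, hw, Matrix.neg_apply]
      rw [Matrix.transpose_mul, Matrix.transpose_mul, hT, Matrix.transpose_transpose]
      simp [mul_assoc]
    rw [hRg] at this
    have := congrFun (congrFun this j) i
    simpa using this
  rw [sum_mul_contract hP hg hφ, hRg]
  simp only [sum_mul_phi0_eq_zero hskew hm, mul_zero, Finset.sum_const_zero]

end StandardForm

end HetG2

namespace HetG2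

/-! ### Calculus of partial derivatives on ℝ⁷ -/

section PartialDerivatives

/-- Partial derivative of a function on `ℝ⁷`. -/
noncomputable def partialDeriv (a : Fin 7) (u : E7 → ℝ) (x : E7) : ℝ :=
  fderiv ℝ u x (EuclideanSpace.single a (1 : ℝ))

variable {u v : E7 → ℝ} {x : E7} {a b : Fin 7}

theorem partialDeriv_congr (h : u =ᶠ[nhds x] v) : partialDeriv a u x = partialDeriv a v x := by
  rw [partialDeriv, partialDeriv, h.fderiv_eq]

theorem partialDeriv_add (hu : DifferentiableAt ℝ u x) (hv : DifferentiableAt ℝ v x) :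
    partialDeriv a (fun y => u y + v y) x = partialDeriv a u x + partialDeriv a v x := by
  simp [partialDeriv, fderiv_fun_add hu hv]

theorem partialDeriv_sub (hu : DifferentiableAt ℝ u x) (hv : DifferentiableAt ℝ v x) :
    partialDeriv a (fun y => u y - v y) x = partialDeriv a u x - partialDeriv a v x := by
  simp [partialDeriv, fderiv_fun_sub hu hv]

theorem partialDeriv_mul (hu : DifferentiableAt ℝ u x) (hv : DifferentiableAt ℝ v x) :
    partialDeriv a (fun y => u y * v y) x
      = partialDeriv a u x * v x + u x * partialDeriv a v x := by
  simp [partialDeriv, fderiv_fun_mul hu hv]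
  ring

theorem partialDeriv_const_mul (hu : DifferentiableAt ℝ u x) (c : ℝ) :
    partialDeriv a (fun y => c * u y) x = c * partialDeriv a u x := by
  simp [partialDeriv, fderiv_const_mul hu c]

theorem partialDeriv_sum {ι : Type*} {s : Finset ι} {f : ι → E7 → ℝ}
    (hf : ∀ i ∈ s, DifferentiableAt ℝ (f i) x) :
    partialDeriv a (fun y => ∑ i ∈ s, f i y) x = ∑ i ∈ s, partialDeriv a (f i) x := by
  simp [partialDeriv, fderiv_fun_sum hf]

theorem partialDeriv_sum_mul {ι : Type*} [Fintype ι] {f k : ι → E7 → ℝ}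
    (hf : ∀ i, DifferentiableAt ℝ (f i) x) (hk : ∀ i, DifferentiableAt ℝ (k i) x) :
    partialDeriv a (fun y => ∑ i, f i y * k i y) x
      = ∑ i, partialDeriv a (f i) x * k i x + ∑ i, f i x * partialDeriv a (k i) x := by
  rw [partialDeriv_sum fun i _ => (hf i).fun_mul (hk i), ← Finset.sum_add_distrib]
  exact Finset.sum_congr rfl fun i _ => partialDeriv_mul (hf i) (hk i)

theorem differentiableAt_partialDeriv (hu : ContDiffAt ℝ ∞ u x) :
    DifferentiableAt ℝ (partialDeriv a u) x := by
  have h : ContDiffAt ℝ 1 (fderiv ℝ u) x := hu.fderiv_right (m := 1) (by norm_cast)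
  exact (h.differentiableAt one_ne_zero).clm_apply (differentiableAt_const _)

theorem partialDeriv_comm (hu : ContDiffAt ℝ ∞ u x) :
    partialDeriv a (partialDeriv b u) x = partialDeriv b (partialDeriv a u) x := by
  have h : ContDiffAt ℝ 1 (fderiv ℝ u) x := hu.fderiv_right (m := 1) (by norm_cast)
  have hd := h.differentiableAt one_ne_zero
  have key : ∀ c d : Fin 7, partialDeriv c (partialDeriv d u) x
      = fderiv ℝ (fderiv ℝ u) x (EuclideanSpace.single c 1) (EuclideanSpace.single d 1) := by
    intro c d
    unfold partialDeriv
    rw [fderiv_clm_apply hd (differentiableAt_const _)]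
    simp
  rw [key, key]
  exact (hu.isSymmSndFDerivAt (by simp; norm_cast)).eq _ _

theorem differentiableAt_matrix_det {n : Type*} [Fintype n] [DecidableEq n]
    {A : n → n → E7 → ℝ} (hA : ∀ i j, DifferentiableAt ℝ (A i j) x) :
    DifferentiableAt ℝ (fun y => (Matrix.of fun i j => A i j y).det) x := by
  simp only [Matrix.det_apply, Matrix.of_apply]
  refine DifferentiableAt.fun_sum fun σ _ => DifferentiableAt.const_smul ?_ _
  exact (HasFDerivAt.finsetProd fun i _ => (hA (σ i) i).hasFDerivAt).differentiableAt

/-- Cramer's rule: each entry of the inverse is a quotient of determinants of matrices with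
differentiable entries. -/
theorem differentiableAt_matrix_inv {n : Type*} [Fintype n] [DecidableEq n]
    {A : n → n → E7 → ℝ} (hA : ∀ i j, DifferentiableAt ℝ (A i j) x)
    (hdet : (Matrix.of fun i j => A i j x).det ≠ 0) (i j : n) :
    DifferentiableAt ℝ (fun y => (Matrix.of fun i j => A i j y)⁻¹ i j) x := by
  simp only [Matrix.inv_def, Ring.inverse_eq_inv', Matrix.smul_apply, smul_eq_mul,
    Matrix.adjugate_apply]
  refine ((differentiableAt_matrix_det hA).inv hdet).mul ?_
  have : ∀ y, (Matrix.of fun i j => A i j y).updateRow j (Pi.single i 1)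
      = Matrix.of fun k l => (if k = j then (Pi.single i (1 : ℝ) : n → ℝ) l else A k l y) := by
    intro y
    ext k l
    simp [Matrix.updateRow_apply]
  simp only [this]
  refine differentiableAt_matrix_det (A := fun k l y =>
    if k = j then (Pi.single i (1 : ℝ) : n → ℝ) l else A k l y) fun k l => ?_
  by_cases hk : k = j
  · simp [hk]
  · simpa [hk] using hA k l

end PartialDerivatives

/-! ### Curvature identities for metric connections on open sets of ℝ⁷ -/

section LocalConnection

/-- The curvature components of a system of connection symbols on an open subset of `ℝ⁷`. -/
noncomputable def localCurvature (S : Fin 7 → Fin 7 → Fin 7 → E7 → ℝ) (a b c d : Fin 7)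
    (x : E7) : ℝ :=
  partialDeriv c (S d a b) x - partialDeriv d (S c a b) x
    + ∑ e, (S c e b x * S d a e x - S d e b x * S c a e x)

variable {U : Set E7} {g : Fin 7 → Fin 7 → E7 → ℝ} {S : Fin 7 → Fin 7 → Fin 7 → E7 → ℝ}
  {h φ : Fin 7 → Fin 7 → Fin 7 → E7 → ℝ} {x : E7}

/-- A connection symbol with its upper index lowered. -/
noncomputable def lowered (g : Fin 7 → Fin 7 → E7 → ℝ) (S : Fin 7 → Fin 7 → Fin 7 → E7 → ℝ)
    (a b c : Fin 7) (x : E7) : ℝ :=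
  ∑ e, g c e x * S a b e x

/-- The scalar product of two covariant derivatives of coordinate vector fields. -/
noncomputable def symbolInner (g : Fin 7 → Fin 7 → E7 → ℝ) (S : Fin 7 → Fin 7 → Fin 7 → E7 → ℝ)
    (a b c d : Fin 7) (x : E7) : ℝ :=
  ∑ e, lowered g S a b e x * S c d e x

theorem symbolInner_comm (hsymm : ∀ a b, g a b x = g b a x) (a b c d : Fin 7) :
    symbolInner g S a b c d x = symbolInner g S c d a b x := by
  simp only [symbolInner, lowered, Finset.sum_mul]
  rw [Finset.sum_comm]
  refine Finset.sum_congr rfl fun e _ => Finset.sum_congr rfl fun f _ => ?_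
  rw [hsymm]
  ring

/-- Moving g inside the derivative of Γ costs a term (∂g)Γ. Metricity splits it in two: one half
cancels the quadratic term of the curvature, the other is a scalar product of covariant derivatives
of coordinate fields. -/
theorem sum_mul_localCurvature (hg : ∀ a b, DifferentiableAt ℝ (g a b) x)
    (hS : ∀ a b c, DifferentiableAt ℝ (S a b c) x)
    (hmet : ∀ a b c, partialDeriv a (g b c) x = lowered g S a b c x + lowered g S a c b x)
    (a b c d : Fin 7) :
    ∑ e, g b e x * localCurvature S a e c d x
      = partialDeriv c (lowered g S d a b) x - partialDeriv d (lowered g S c a b) x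
        - symbolInner g S c b d a x + symbolInner g S d b c a x := by
  have hd : ∀ c d, partialDeriv c (lowered g S d a b) x
      = symbolInner g S c b d a x + ∑ e, lowered g S c e b x * S d a e x
        + ∑ e, g b e x * partialDeriv c (S d a e) x := fun c d => by
    have := partialDeriv_sum_mul (x := x) (a := c) (f := fun e => g b e) (k := fun e => S d a e)
      (fun e => hg b e) fun e => hS d a e
    rw [show lowered g S d a b = fun y => ∑ e, g b e y * S d a e y from rfl, this]
    simp only [hmet, add_mul, Finset.sum_add_distrib, symbolInner]
  have hq : ∀ c d, ∑ e, g b e x * ∑ f, S c f e x * S d a f x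
      = ∑ e, lowered g S c e b x * S d a e x := fun c d => by
    simp only [lowered, Finset.mul_sum, Finset.sum_mul, mul_assoc]
    exact Finset.sum_comm
  rw [hd, hd, ← hq, ← hq]
  simp only [localCurvature, mul_add, mul_sub, Finset.sum_add_distrib, Finset.sum_sub_distrib]
  ring

/-- The Koszul formula for a metric connection with totally antisymmetric torsion. -/
theorem lowered_eq_koszul
    (hmet : ∀ a b c, partialDeriv a (g b c) x = lowered g S a b c x + lowered g S a c b x)
    (htor : ∀ a b c, lowered g S a b c x - lowered g S b a c x = h a b c x)
    (h12 : ∀ a b c, h a b c x = -h b a c x) (h23 : ∀ a b c, h a b c x = -h a c b x)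
    (a b c : Fin 7) :
    lowered g S a b c x = 1 / 2 * (partialDeriv a (g b c) x + partialDeriv b (g a c) x
      - partialDeriv c (g a b) x + h a b c x) := by
  rw [hmet, hmet, hmet]
  linarith [htor a b c, htor a c b, htor b c a, h12 a b c, h23 a b c, h12 b c a, h23 b c a,
    h12 c b a, h23 c b a, h12 a c b, h23 b a c]

theorem symbol_eq_sum_inv (hdet : IsUnit (Matrix.of fun p q => g p q x).det) (a b c : Fin 7) :
    S a b c x = ∑ d, (Matrix.of fun p q => g p q x)⁻¹ c d * lowered g S a b d x := by
  have h1 : (fun d => lowered g S a b d x)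
      = (Matrix.of fun p q => g p q x).mulVec (fun e => S a b e x) := by
    ext d; rfl
  change _ = ((Matrix.of fun p q => g p q x)⁻¹.mulVec fun d => lowered g S a b d x) c
  rw [h1, Matrix.mulVec_mulVec, Matrix.nonsing_inv_mul _ hdet, Matrix.one_mulVec]

/-- The symbols of a metric connection with totally antisymmetric smooth torsion are
differentiable. -/
theorem differentiableAt_symbol (hU : IsOpen U) (hx : x ∈ U)
    (hg : ∀ a b, ContDiffOn ℝ ∞ (g a b) U) (hh : ∀ a b c, DifferentiableAt ℝ (h a b c) x)
    (hdet : ∀ y ∈ U, IsUnit (Matrix.of fun p q => g p q y).det)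
    (hmet : ∀ y ∈ U, ∀ a b c,
      partialDeriv a (g b c) y = lowered g S a b c y + lowered g S a c b y)
    (htor : ∀ y ∈ U, ∀ a b c, lowered g S a b c y - lowered g S b a c y = h a b c y)
    (h12 : ∀ y a b c, h a b c y = -h b a c y) (h23 : ∀ y a b c, h a b c y = -h a c b y)
    (a b c : Fin 7) : DifferentiableAt ℝ (S a b c) x := by
  have hgx : ∀ a b, ContDiffAt ℝ ∞ (g a b) x := fun a b => (hg a b).contDiffAt (hU.mem_nhds hx)
  have hgd : ∀ a b, DifferentiableAt ℝ (g a b) x := fun a b => (hgx a b).differentiableAt (by simp)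
  -- The Koszul formula with its index raised expresses the symbols through g⁻¹, ∂g and the torsion,
  -- all of which are differentiable.
  have heq : S a b c =ᶠ[nhds x] fun y => ∑ d, (Matrix.of fun p q => g p q y)⁻¹ c d
      * (1 / 2 * (partialDeriv a (g b d) y + partialDeriv b (g a d) y
        - partialDeriv d (g a b) y + h a b d y)) := by
    filter_upwards [hU.mem_nhds hx] with y hy
    rw [symbol_eq_sum_inv (S := S) (hdet y hy) a b c]
    refine Finset.sum_congr rfl fun d _ => ?_
    rw [lowered_eq_koszul (hmet y hy) (htor y hy) (h12 y) (h23 y)]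
  refine DifferentiableAt.congr_of_eventuallyEq ?_ heq
  refine DifferentiableAt.fun_sum fun d _ => ?_
  refine (differentiableAt_matrix_inv hgd (hdet x hx).ne_zero c d).mul ?_
  exact ((((differentiableAt_partialDeriv (hgx b d)).add
    (differentiableAt_partialDeriv (hgx a d))).sub
    (differentiableAt_partialDeriv (hgx a b))).add (hh a b d)).const_mul _

/-- The curvatures of a metric connection with totally antisymmetric torsion and of the connection
with the opposite torsion agree up to exchange of index pairs and the differential of the torsion.
-/
theorem localCurvature_sub_transposed (hU : IsOpen U) (hx : x ∈ U)
    (hg : ∀ a b, ContDiffOn ℝ ∞ (g a b) U) (hh : ∀ a b c, DifferentiableAt ℝ (h a b c) x)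
    (hsymm : ∀ y ∈ U, ∀ a b, g a b y = g b a y)
    (hdet : ∀ y ∈ U, IsUnit (Matrix.of fun p q => g p q y).det)
    (hmet : ∀ y ∈ U, ∀ a b c,
      partialDeriv a (g b c) y = lowered g S a b c y + lowered g S a c b y)
    (htor : ∀ y ∈ U, ∀ a b c, lowered g S a b c y - lowered g S b a c y = h a b c y)
    (h12 : ∀ y a b c, h a b c y = -h b a c y) (h23 : ∀ y a b c, h a b c y = -h a c b y)
    (a b c d : Fin 7) :
    ∑ e, g d e x * localCurvature S c e a b x
      - ∑ e, g b e x * localCurvature (fun p q r => S q p r) a e c d x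
      = 1 / 2 * (partialDeriv a (h b c d) x - partialDeriv b (h a c d) x
        + partialDeriv c (h a b d) x - partialDeriv d (h a b c) x) := by
  have hgx : ∀ a b, ContDiffAt ℝ ∞ (g a b) x := fun a b => (hg a b).contDiffAt (hU.mem_nhds hx)
  have hgd : ∀ a b, DifferentiableAt ℝ (g a b) x := fun a b => (hgx a b).differentiableAt (by simp)
  have hS := differentiableAt_symbol hU hx hg hh hdet hmet htor h12 h23
  -- Transposing the symbols subtracts h_abc + h_acb from the metricity equation, and this vanishes
  -- by skewness.
  have hmet' : ∀ a b c, partialDeriv a (g b c) x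
      = lowered g (fun p q r => S q p r) a b c x + lowered g (fun p q r => S q p r) a c b x :=
    fun a b c => by
      change _ = lowered g S b a c x + lowered g S c a b x
      rw [hmet x hx]
      linarith [htor x hx a b c, htor x hx a c b, h23 x a b c]
  have hL : ∀ p a b c, partialDeriv p (lowered g S a b c) x
      = 1 / 2 * (partialDeriv p (partialDeriv a (g b c)) x
        + partialDeriv p (partialDeriv b (g a c)) x
        - partialDeriv p (partialDeriv c (g a b)) x + partialDeriv p (h a b c) x) := by
    intro p a b c
    have heq : lowered g S a b c =ᶠ[nhds x] fun y => 1 / 2 * (partialDeriv a (g b c) y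
        + partialDeriv b (g a c) y - partialDeriv c (g a b) y + h a b c y) := by
      filter_upwards [hU.mem_nhds hx] with y hy
      exact lowered_eq_koszul (hmet y hy) (htor y hy) (h12 y) (h23 y) a b c
    have d1 := differentiableAt_partialDeriv (a := a) (hgx b c)
    have d2 := differentiableAt_partialDeriv (a := b) (hgx a c)
    have d3 := differentiableAt_partialDeriv (a := c) (hgx a b)
    rw [partialDeriv_congr heq,
      partialDeriv_const_mul (((d1.fun_add d2).fun_sub d3).fun_add (hh a b c)),
      partialDeriv_add ((d1.fun_add d2).fun_sub d3) (hh a b c),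
      partialDeriv_sub (d1.fun_add d2) d3, partialDeriv_add d1 d2]
  have hgs : ∀ p q a b, partialDeriv p (partialDeriv q (g a b)) x
      = partialDeriv p (partialDeriv q (g b a)) x := fun p q a b => by
    refine partialDeriv_congr ?_
    filter_upwards [hU.mem_nhds hx] with y hy
    refine partialDeriv_congr ?_
    filter_upwards [hU.mem_nhds hy] with z hz using hsymm z hz a b
  have hc : ∀ p q a b, partialDeriv p (partialDeriv q (g a b)) x
      = partialDeriv q (partialDeriv p (g a b)) x := fun p q a b => partialDeriv_comm (hgx a b)
  have hh23 : ∀ p a b c, partialDeriv p (h a b c) x = -partialDeriv p (h a c b) x := by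
    intro p a b c
    rw [show h a b c = fun y => -h a c b y from funext fun y => h23 y a b c]
    simp [partialDeriv, fderiv_fun_neg]
  rw [sum_mul_localCurvature hgd hS (hmet x hx),
    sum_mul_localCurvature hgd (fun a b c => hS b a c) hmet']
  change _ - (partialDeriv c (lowered g S a d b) x - partialDeriv d (lowered g S a c b) x
    - symbolInner g S b c a d x + symbolInner g S b d a c x) = _
  -- The quadratic terms now agree on both sides. What remains is linear: second derivatives of g
  -- cancel by commuting partials and the symmetry of g, and the derivatives of h assemble to half
  -- its exterior derivative.
  rw [symbolInner_comm (hsymm x hx) b c a d, hL, hL, hL, hL]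
  linarith [hc a b c d, hc a c b d, hc a d b c, hc b c a d, hc b d a c, hc c d a b,
    hgs c a d b, hgs c d a b, hgs d a b c, hgs d c a b, hgs c b a d, hgs d b a c, hgs a c b d,
    hgs b a d c, hh23 c a d b, hh23 d a c b]

/-- The curvature of a metric connection takes values in skew endomorphisms. -/
theorem sum_mul_localCurvature_antisymm (hU : IsOpen U) (hx : x ∈ U)
    (hg : ∀ a b, ContDiffOn ℝ ∞ (g a b) U) (hS : ∀ a b c, DifferentiableAt ℝ (S a b c) x)
    (hsymm : ∀ y ∈ U, ∀ a b, g a b y = g b a y)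
    (hmet : ∀ y ∈ U, ∀ a b c,
      partialDeriv a (g b c) y = lowered g S a b c y + lowered g S a c b y)
    (a b c d : Fin 7) :
    ∑ e, g b e x * localCurvature S a e c d x = -∑ e, g a e x * localCurvature S b e c d x := by
  have hgx : ∀ a b, ContDiffAt ℝ ∞ (g a b) x := fun a b => (hg a b).contDiffAt (hU.mem_nhds hx)
  have hgd : ∀ a b, DifferentiableAt ℝ (g a b) x := fun a b => (hgx a b).differentiableAt (by simp)
  have hLd : ∀ a b c, DifferentiableAt ℝ (lowered g S a b c) x := fun a b c =>
    DifferentiableAt.fun_sum fun e _ => (hgd c e).mul (hS a b e)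
  have hm : ∀ c d, partialDeriv c (partialDeriv d (g a b)) x
      = partialDeriv c (lowered g S d a b) x + partialDeriv c (lowered g S d b a) x := by
    intro c d
    rw [← partialDeriv_add (hLd d a b) (hLd d b a)]
    refine partialDeriv_congr ?_
    filter_upwards [hU.mem_nhds hx] with y hy using hmet y hy d a b
  rw [sum_mul_localCurvature hgd hS (hmet x hx), sum_mul_localCurvature hgd hS (hmet x hx),
    symbolInner_comm (hsymm x hx) c a d b, symbolInner_comm (hsymm x hx) d a c b]
  linarith [hm c d, hm d c, partialDeriv_comm (a := c) (b := d) (hgx a b)]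

/-- The curvature of a connection preserving a three-index tensor annihilates it. -/
theorem slotAction_localCurvature (hU : IsOpen U) (hx : x ∈ U)
    (hφ : ∀ a b c, ContDiffOn ℝ ∞ (φ a b c) U)
    (hS : ∀ a b c, DifferentiableAt ℝ (S a b c) x)
    (hpar : ∀ y ∈ U, ∀ a b c d, partialDeriv a (φ b c d) y
      = slotAction (Matrix.of fun p q => S a p q y) (fun p q r => φ p q r y) b c d)
    (c d : Fin 7) :
    slotAction (Matrix.of fun p q => localCurvature S p q c d x) (fun p q r => φ p q r x) = 0 := by
  have hφx : ∀ a b c, ContDiffAt ℝ ∞ (φ a b c) x := fun a b c =>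
    (hφ a b c).contDiffAt (hU.mem_nhds hx)
  have hφd : ∀ a b c, DifferentiableAt ℝ (φ a b c) x := fun a b c =>
    (hφx a b c).differentiableAt (by simp)
  -- The equation ∂_a φ = S_a·φ is differentiated once more and used again to eliminate the
  -- derivative of φ.
  have hsecond : ∀ f a i j k, partialDeriv f (partialDeriv a (φ i j k)) x
      = slotAction (Matrix.of fun p q => partialDeriv f (S a p q) x) (fun p q r => φ p q r x) i j k
        + slotAction (Matrix.of fun p q => S a p q x)
          (slotAction (Matrix.of fun p q => S f p q x) (fun p q r => φ p q r x)) i j k := by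
    intro f a i j k
    have heq : partialDeriv a (φ i j k) =ᶠ[nhds x] fun y => ∑ e, S a i e y * φ e j k y
        + ∑ e, S a j e y * φ i e k y + ∑ e, S a k e y * φ i j e y := by
      filter_upwards [hU.mem_nhds hx] with y hy using hpar y hy a i j k
    have e1 : ∀ i (t : Fin 7 → E7 → ℝ), (∀ e, DifferentiableAt ℝ (t e) x) →
        DifferentiableAt ℝ (fun y => ∑ e, S a i e y * t e y) x := fun i t ht =>
      DifferentiableAt.fun_sum fun e _ => (hS a i e).mul (ht e)
    rw [partialDeriv_congr heq,
      partialDeriv_add ((e1 i _ fun e => hφd e j k).fun_add (e1 j _ fun e => hφd i e k))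
        (e1 k _ fun e => hφd i j e),
      partialDeriv_add (e1 i _ fun e => hφd e j k) (e1 j _ fun e => hφd i e k),
      partialDeriv_sum_mul (fun e => hS a i e) (fun e => hφd e j k),
      partialDeriv_sum_mul (fun e => hS a j e) (fun e => hφd i e k),
      partialDeriv_sum_mul (fun e => hS a k e) (fun e => hφd i j e)]
    simp only [hpar x hx]
    generalize slotAction (Matrix.of fun p q => S f p q x) (fun p q r => φ p q r x) = t
    rw [slotAction_apply, slotAction_apply]
    simp only [Matrix.of_apply]
    ring
  have hcomm := slotAction_commutator (Matrix.of fun p q => S d p q x)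
    (Matrix.of fun p q => S c p q x) (fun p q r => φ p q r x)
  have hlin : ∀ (A B C D : Matrix (Fin 7) (Fin 7) ℝ) (t : Fin 7 → Fin 7 → Fin 7 → ℝ) (i j k),
      slotAction (A - B + (C - D)) t i j k
        = slotAction A t i j k - slotAction B t i j k + slotAction (C - D) t i j k := by
    intro A B C D t i j k
    simp only [slotAction, slot1, slot2, slot3, Pi.add_apply, Matrix.add_apply, Matrix.sub_apply,
      add_mul, sub_mul, Finset.sum_add_distrib, Finset.sum_sub_distrib]
    ring
  -- Rows carry the lower index, so Γ_ce^b Γ_da^e is an entry of S_d S_c: the products occur in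
  -- reversed order, exactly as in S_d·(S_c·φ).
  have hmat : (Matrix.of fun p q => localCurvature S p q c d x)
      = (Matrix.of fun p q => partialDeriv c (S d p q) x)
        - (Matrix.of fun p q => partialDeriv d (S c p q) x)
        + ((Matrix.of fun p q => S d p q x) * (Matrix.of fun p q => S c p q x)
          - (Matrix.of fun p q => S c p q x) * (Matrix.of fun p q => S d p q x)) := by
    ext p q
    simp only [localCurvature, Matrix.of_apply, Matrix.add_apply, Matrix.sub_apply,
      Matrix.mul_apply, ← Finset.sum_sub_distrib]
    congr 1
    exact Finset.sum_congr rfl fun e _ => by ring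
  ext i j k
  rw [hmat, hlin, ← hcomm]
  have h1 := hsecond c d i j k
  have h2 := hsecond d c i j k
  have h3 := partialDeriv_comm (a := c) (b := d) (hφx i j k)
  simp only [Pi.sub_apply, Pi.zero_apply]
  linarith

end LocalConnection

end HetG2

namespace HetG2

/-! ### Components of alternating three-forms under a change of basis -/

section Trilinear

variable {N : Type*} [AddCommGroup N] [Module ℝ N] [TopologicalSpace N]

theorem alternating3_swap_left (f : N [⋀^Fin 3]→L[ℝ] ℝ) (u v w : N) :
    f ![u, v, w] = -f ![v, u, w] := by
  have h := f.toAlternatingMap.map_swap ![v, u, w] (i := 0) (j := 1) (by decide)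
  have e : (![v, u, w] ∘ Equiv.swap (0 : Fin 3) 1) = ![u, v, w] := by
    ext i
    fin_cases i <;> simp [Equiv.swap_apply_def]
  rw [e] at h
  exact h

theorem alternating3_swap_right (f : N [⋀^Fin 3]→L[ℝ] ℝ) (u v w : N) :
    f ![u, v, w] = -f ![u, w, v] := by
  have h := f.toAlternatingMap.map_swap ![u, w, v] (i := 1) (j := 2) (by decide)
  have e : (![u, w, v] ∘ Equiv.swap (1 : Fin 3) 2) = ![u, v, w] := by
    ext i
    fin_cases i <;> simp [Equiv.swap_apply_def]
  rw [e] at h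
  exact h

theorem alternating3_sum_left {ι : Type*} [Fintype ι] (f : N [⋀^Fin 3]→L[ℝ] ℝ) (c : ι → ℝ)
    (b : ι → N) (v w : N) : f ![∑ i, c i • b i, v, w] = ∑ i, c i * f ![b i, v, w] := by
  have e : ∀ u, f ![u, v, w] = f.toMultilinearMap.toLinearMap ![0, v, w] 0 u := fun u => by
    simp only [MultilinearMap.toLinearMap_apply]
    change f _ = f _
    congr 1
    ext i
    fin_cases i <;> simp
  simp only [e, map_sum, map_smul, smul_eq_mul]

/-- Linearity in the first argument is carried to the other two by transpositions; expanding all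
three arguments produces one factor of P per slot. -/
theorem alternating3_sum {ι : Type*} [Fintype ι] (f : N [⋀^Fin 3]→L[ℝ] ℝ) (P : Matrix ι ι ℝ)
    (b e : ι → N) (he : ∀ a, e a = ∑ i, P a i • b i) :
    (fun x y z => f ![e x, e y, e z])
      = slot1 P (slot2 P (slot3 P fun i j k => f ![b i, b j, b k])) := by
  have h2 : ∀ (c : ι → ℝ) (u w : N), f ![u, ∑ i, c i • b i, w] = ∑ i, c i * f ![u, b i, w] := by
    intro c u w
    rw [alternating3_swap_left, alternating3_sum_left, ← Finset.sum_neg_distrib]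
    exact Finset.sum_congr rfl fun i _ => by rw [alternating3_swap_left f u]; ring
  have h3 : ∀ (c : ι → ℝ) (u v : N), f ![u, v, ∑ i, c i • b i] = ∑ i, c i * f ![u, v, b i] := by
    intro c u v
    rw [alternating3_swap_right, h2, ← Finset.sum_neg_distrib]
    exact Finset.sum_congr rfl fun i _ => by rw [alternating3_swap_right f u v]; ring
  ext x y z
  simp only [slot1, slot2, slot3, ← h3, ← h2, ← alternating3_sum_left, ← he]

end Trilinear

/-! ### Transfer of the local identities to a manifold -/

section Charts

variable {Y : Type*} [TopologicalSpace Y] [ChartedSpace E7 Y]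

/-- A function on `Y` read in the chart at `y₀`. -/
def inChart (y₀ : Y) (u : Y → ℝ) (x : E7) : ℝ :=
  u ((chartAt E7 y₀).symm x)

theorem inChart_chart {y₀ y : Y} (hy : y ∈ (chartAt E7 y₀).source) (u : Y → ℝ) :
    inChart y₀ u (chartAt E7 y₀ y) = u y := by
  rw [inChart, (chartAt E7 y₀).left_inv hy]

theorem pd_eq_partialDeriv (y₀ : Y) (a : Fin 7) (u : Y → ℝ) (y : Y) :
    pd y₀ a u y = partialDeriv a (inChart y₀ u) (chartAt E7 y₀ y) :=
  rfl

theorem partialDeriv_inChart {y₀ : Y} {x : E7} (hx : x ∈ (chartAt E7 y₀).target) (a : Fin 7)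
    (u : Y → ℝ) :
    partialDeriv a (inChart y₀ u) x = pd y₀ a u ((chartAt E7 y₀).symm x) := by
  rw [pd_eq_partialDeriv, (chartAt E7 y₀).right_inv hx]

theorem curvature_eq_localCurvature {y₀ y : Y} (hy : y ∈ (chartAt E7 y₀).source)
    (S : Fin 7 → Fin 7 → Fin 7 → Y → ℝ) (a b c d : Fin 7) :
    curvature y₀ S a b c d y
      = localCurvature (fun p q r => inChart y₀ (S p q r)) a b c d (chartAt E7 y₀ y) := by
  simp only [curvature, localCurvature, inChart_chart hy, pd_eq_partialDeriv]

variable [IsManifold (𝓡 7) ∞ Y]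

theorem contDiffOn_inChart {y₀ : Y} {u : Y → ℝ}
    (hu : ContMDiffOn (𝓡 7) 𝓘(ℝ) ∞ u (chartAt E7 y₀).source) :
    ContDiffOn ℝ ∞ (inChart y₀ u) (chartAt E7 y₀).target := by
  have h := hu.comp (contMDiffOn_chart_symm (I := 𝓡 7) (n := ∞) (x := y₀))
    (chartAt E7 y₀).mapsTo_symm
  exact contMDiffOn_iff_contDiffOn.1 h

theorem tangentTriv_baseSet (y₀ : Y) : (tangentTriv y₀).baseSet = (chartAt E7 y₀).source := by
  simp [tangentTriv]

/-- The coordinate basis of a tangent space. -/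
noncomputable def coordBasis (y₀ : Y) {y : Y} (hy : y ∈ (chartAt E7 y₀).source) :
    Module.Basis (Fin 7) ℝ (TangentSpace (𝓡 7) y) :=
  (tangentTriv y₀).basisAt (EuclideanSpace.basisFun (Fin 7) ℝ).toBasis
    (by rwa [tangentTriv_baseSet])

theorem coordBasis_apply {y₀ y : Y} (hy : y ∈ (chartAt E7 y₀).source) (a : Fin 7) :
    coordBasis y₀ hy a = coordField y₀ a y := by
  rw [coordField, Trivialization.localFrame_apply_of_mem_baseSet, coordBasis]

theorem contMDiffOn_coordField (y₀ : Y) (a : Fin 7) :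
    ContMDiffOn (𝓡 7) ((𝓡 7).prod 𝓘(ℝ, E7)) ∞
      (fun y => (⟨y, coordField y₀ a y⟩ : TotalSpace E7 (TangentSpace (𝓡 7) : Y → Type)))
      (chartAt E7 y₀).source := by
  rw [← tangentTriv_baseSet]
  exact (tangentTriv y₀).contMDiffOn_localFrame_baseSet ∞ _ a

namespace G2Structure

variable (S : G2Structure Y)

theorem contMDiffOn_gComp (y₀ : Y) (a b : Fin 7) :
    ContMDiffOn (𝓡 7) 𝓘(ℝ) ∞ (S.gComp y₀ a b) (chartAt E7 y₀).source := by
  intro y hy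
  have h : ContMDiffWithinAt (𝓡 7) ((𝓡 7).prod 𝓘(ℝ)) ∞
      (fun m => TotalSpace.mk' ℝ (E := Bundle.Trivial Y ℝ) m
        (S.g.inner m (coordField y₀ a m) (coordField y₀ b m))) (chartAt E7 y₀).source y := by
    apply ContMDiffWithinAt.clm_bundle_apply₂ (F₁ := E7) (F₂ := E7)
    · exact S.g.contMDiff.contMDiffAt.contMDiffWithinAt
    · exact contMDiffOn_coordField y₀ a y hy
    · exact contMDiffOn_coordField y₀ b y hy
  simp only [contMDiffWithinAt_totalSpace] at h
  exact h.2

theorem gComp_symm (y₀ : Y) (a b : Fin 7) (y : Y) : S.gComp y₀ a b y = S.gComp y₀ b a y :=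
  S.g.symm y _ _

theorem phiComp_swap_left (y₀ : Y) (a b c : Fin 7) (y : Y) :
    S.phiComp y₀ a b c y = -S.phiComp y₀ b a c y :=
  alternating3_swap_left _ _ _ _

/-- The components of a `G₂` structure in a chart arise from the standard ones by a change of
basis. -/
theorem exists_adapted_matrix {y₀ y : Y} (hy : y ∈ (chartAt E7 y₀).source) :
    ∃ P : Matrix (Fin 7) (Fin 7) ℝ, IsUnit P.det ∧
      (Matrix.of fun p q => S.gComp y₀ p q y) = P * P.transpose ∧
      (fun a b c => S.phiComp y₀ a b c y) = slot1 P (slot2 P (slot3 P phi0)) := by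
  obtain ⟨b, hg, hφ⟩ := S.adapted y
  have he : ∀ a, coordField y₀ a y = ∑ i, (b.toMatrix (coordBasis y₀ hy)).transpose a i • b i := by
    intro a
    simp only [Matrix.transpose_apply, Module.Basis.toMatrix_apply, b.sum_repr, coordBasis_apply]
  -- The transpose is taken so that row a lists the components of ∂_a in the adapted basis;
  -- orthonormality then reads g = P Pᵀ.
  refine ⟨(b.toMatrix (coordBasis y₀ hy)).transpose, ?_, ?_, ?_⟩
  · rw [Matrix.det_transpose]
    have := b.invertibleToMatrix (coordBasis y₀ hy)
    exact Matrix.isUnit_det_of_invertible _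
  · ext p q
    simp only [Matrix.of_apply, gComp, he p, he q, map_sum, map_smul,
      sum_apply, smul_apply, hg, smul_eq_mul, mul_ite,
      mul_one, mul_zero, Finset.sum_ite_eq', Finset.mem_univ, if_true, Matrix.mul_apply,
      Matrix.transpose_apply]
    exact Finset.sum_congr rfl fun _ _ => mul_comm _ _
  · have h := alternating3_sum (S.phi.form y) (b.toMatrix (coordBasis y₀ hy)).transpose b
      (fun a => coordField y₀ a y) he
    simp only [hφ] at h
    exact h

theorem isUnit_det_gComp {y₀ y : Y} (hy : y ∈ (chartAt E7 y₀).source) :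
    IsUnit (Matrix.of fun p q => S.gComp y₀ p q y).det := by
  obtain ⟨P, hP, hg, -⟩ := S.exists_adapted_matrix hy
  rw [hg, Matrix.det_mul, Matrix.det_transpose]
  exact hP.mul hP

/-- Index raising is written as a slot action so that the matrix lemmas about adapted forms apply.
-/
theorem phiUp_eq_slots (y₀ : Y) (c d e : Fin 7) (y : Y) :
    S.phiUp y₀ c d e y
      = slot1 (Matrix.of fun p q => S.gComp y₀ p q y)⁻¹
          (slot2 (Matrix.of fun p q => S.gComp y₀ p q y)⁻¹ fun p q r => S.phiComp y₀ p q r y)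
          c d e := by
  simp only [phiUp, gInv, slot1, slot2, Finset.mul_sum, mul_assoc]

theorem phiUp_swap (y₀ : Y) (c d e : Fin 7) (y : Y) :
    S.phiUp y₀ c d e y = -S.phiUp y₀ d c e y := by
  simp only [phiUp]
  rw [Finset.sum_comm, ← Finset.sum_neg_distrib]
  refine Finset.sum_congr rfl fun p _ => ?_
  rw [← Finset.sum_neg_distrib]
  refine Finset.sum_congr rfl fun q _ => ?_
  rw [S.phiComp_swap_left y₀ q p]
  ring

end G2Structure

namespace IsSkewG2Connection

variable {S : G2Structure Y} {H : ThreeForm Y}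
  {cov : CovariantDerivative (𝓡 7) E7 (TangentSpace (𝓡 7) : Y → Type)}

theorem partialDeriv_metric (hcov : IsSkewG2Connection S H cov) (y₀ : Y) {x : E7}
    (hx : x ∈ (chartAt E7 y₀).target) (a b c : Fin 7) :
    partialDeriv a (inChart y₀ (S.gComp y₀ b c)) x
      = lowered (fun p q => inChart y₀ (S.gComp y₀ p q))
          (fun p q r => inChart y₀ (symbols cov y₀ p q r)) a b c x
        + lowered (fun p q => inChart y₀ (S.gComp y₀ p q))
          (fun p q r => inChart y₀ (symbols cov y₀ p q r)) a c b x := by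
  have h := hcov.metric y₀ _ ((chartAt E7 y₀).map_target hx) a b c
  rw [partialDeriv_inChart hx]
  simp only [lowered, inChart]
  simp only [S.gComp_symm y₀ c, mul_comm (S.gComp y₀ _ _ _)]
  linarith

theorem lowered_torsion (hcov : IsSkewG2Connection S H cov) (y₀ : Y) {x : E7}
    (hx : x ∈ (chartAt E7 y₀).target) (a b c : Fin 7) :
    lowered (fun p q => inChart y₀ (S.gComp y₀ p q))
        (fun p q r => inChart y₀ (symbols cov y₀ p q r)) a b c x
      - lowered (fun p q => inChart y₀ (S.gComp y₀ p q))
        (fun p q r => inChart y₀ (symbols cov y₀ p q r)) b a c x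
      = inChart y₀ (comp3 H.form y₀ a b c) x := by
  have h := hcov.torsion y₀ _ ((chartAt E7 y₀).map_target hx) a b c
  simp only [mul_sub, Finset.sum_sub_distrib] at h
  exact h

theorem differentiableAt_symbols (hcov : IsSkewG2Connection S H cov) (y₀ : Y) {y : Y}
    (hy : y ∈ (chartAt E7 y₀).source) (a b c : Fin 7) :
    DifferentiableAt ℝ (inChart y₀ (symbols cov y₀ a b c)) (chartAt E7 y₀ y) :=
  differentiableAt_symbol (g := fun p q => inChart y₀ (S.gComp y₀ p q))
    (S := fun p q r => inChart y₀ (symbols cov y₀ p q r))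
    (h := fun p q r => inChart y₀ (comp3 H.form y₀ p q r))
    (chartAt E7 y₀).open_target ((chartAt E7 y₀).map_source hy)
    (fun a b => contDiffOn_inChart (S.contMDiffOn_gComp y₀ a b))
    (fun a b c => ((contDiffOn_inChart (H.smooth y₀ a b c)).contDiffAt
      ((chartAt E7 y₀).open_target.mem_nhds ((chartAt E7 y₀).map_source hy))).differentiableAt
      (by simp))
    (fun _ hx => S.isUnit_det_gComp ((chartAt E7 y₀).map_target hx))
    (fun _ hx => hcov.partialDeriv_metric y₀ hx) (fun _ hx => hcov.lowered_torsion y₀ hx)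
    (fun _ _ _ _ => alternating3_swap_left _ _ _ _)
    (fun _ _ _ _ => alternating3_swap_right _ _ _ _) a b c

/-- The curvatures of a skew torsion `G₂` connection and of its associated connection. -/
theorem curvNabla_sub_curvTheta (hcov : IsSkewG2Connection S H cov) {y₀ y : Y}
    (hy : y ∈ (chartAt E7 y₀).source) (a b c d : Fin 7) :
    curvNabla S cov y₀ c d a b y - curvTheta S cov y₀ a b c d y
      = 1 / 2 * dThree y₀ (comp3 H.form y₀) a b c d y := by
  have h := localCurvature_sub_transposed (g := fun p q => inChart y₀ (S.gComp y₀ p q))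
    (S := fun p q r => inChart y₀ (symbols cov y₀ p q r))
    (h := fun p q r => inChart y₀ (comp3 H.form y₀ p q r))
    (chartAt E7 y₀).open_target ((chartAt E7 y₀).map_source hy)
    (fun a b => contDiffOn_inChart (S.contMDiffOn_gComp y₀ a b))
    (fun a b c => ((contDiffOn_inChart (H.smooth y₀ a b c)).contDiffAt
      ((chartAt E7 y₀).open_target.mem_nhds ((chartAt E7 y₀).map_source hy))).differentiableAt
      (by simp))
    (fun _ _ _ _ => S.gComp_symm y₀ _ _ _)
    (fun _ hx => S.isUnit_det_gComp ((chartAt E7 y₀).map_target hx))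
    (fun _ hx => hcov.partialDeriv_metric y₀ hx) (fun _ hx => hcov.lowered_torsion y₀ hx)
    (fun _ _ _ _ => alternating3_swap_left _ _ _ _)
    (fun _ _ _ _ => alternating3_swap_right _ _ _ _) a b c d
  simp only [inChart_chart hy] at h
  simp only [curvNabla, curvTheta, curvature_eq_localCurvature hy, dThree, pd_eq_partialDeriv]
  exact h

/-- The curvature of a `G₂` connection takes values in the Lie algebra of `G₂`. -/
theorem sum_curvNabla_mul_phiUp (hcov : IsSkewG2Connection S H cov) {y₀ y : Y}
    (hy : y ∈ (chartAt E7 y₀).source) (a b e : Fin 7) :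
    ∑ c, ∑ d, curvNabla S cov y₀ c d a b y * S.phiUp y₀ c d e y = 0 := by
  obtain ⟨P, hP, hg, hφ⟩ := S.exists_adapted_matrix hy
  have hRg : ∀ c d, ((Matrix.of fun p q => curvature y₀ (symbols cov y₀) p q a b y)
      * (Matrix.of fun p q => S.gComp y₀ p q y)) c d = curvNabla S cov y₀ c d a b y := by
    intro c d
    simp only [Matrix.mul_apply, Matrix.of_apply, curvNabla]
    exact Finset.sum_congr rfl fun q _ => by rw [S.gComp_symm y₀ q d, mul_comm]
  have hskew : ∀ c d, curvNabla S cov y₀ c d a b y = -curvNabla S cov y₀ d c a b y := by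
    intro c d
    have h := sum_mul_localCurvature_antisymm (g := fun p q => inChart y₀ (S.gComp y₀ p q))
      (S := fun p q r => inChart y₀ (symbols cov y₀ p q r))
      (chartAt E7 y₀).open_target ((chartAt E7 y₀).map_source hy)
      (fun a b => contDiffOn_inChart (S.contMDiffOn_gComp y₀ a b))
      (fun a b c => hcov.differentiableAt_symbols y₀ hy a b c)
      (fun _ _ _ _ => S.gComp_symm y₀ _ _ _)
      (fun _ hx => hcov.partialDeriv_metric y₀ hx) c d a b
    simp only [inChart_chart hy] at h
    simpa only [curvNabla, curvature_eq_localCurvature hy] using h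
  have hR : slotAction (Matrix.of fun p q => curvature y₀ (symbols cov y₀) p q a b y)
      (fun p q r => S.phiComp y₀ p q r y) = 0 := by
    have h := slotAction_localCurvature (φ := fun p q r => inChart y₀ (S.phiComp y₀ p q r))
      (S := fun p q r => inChart y₀ (symbols cov y₀ p q r))
      (chartAt E7 y₀).open_target ((chartAt E7 y₀).map_source hy)
      (fun a b c => contDiffOn_inChart (S.phi.smooth y₀ a b c))
      (fun a b c => hcov.differentiableAt_symbols y₀ hy a b c)
      (fun x hx p q r s => by
        have := hcov.parallel y₀ _ ((chartAt E7 y₀).map_target hx) p q r s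
        rw [partialDeriv_inChart hx, slotAction_apply]
        simp only [Matrix.of_apply, inChart]
        linarith) a b
    simp only [inChart_chart hy] at h
    simpa only [curvature_eq_localCurvature hy] using h
  -- For fixed form indices a, b the curvature is an endomorphism that is skew for g and annihilates
  -- φ, which is what the algebraic lemma requires.
  have key := sum_mul_contract_eq_zero hP hg hφ
    (R := Matrix.of fun p q => curvature y₀ (symbols cov y₀) p q a b y)
    (fun i j => by rw [hRg, hRg, hskew]) hR e
  simpa only [hRg, ← S.phiUp_eq_slots] using key

end IsSkewG2Connection

/-! ### Instantons and the contraction of the Bianchi identity -/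

section Gauge

variable {F : Type*} [NormedAddCommGroup F] [NormedSpace ℝ F] [FiniteDimensional ℝ F]
  {V : Y → Type*} [TopologicalSpace (TotalSpace F V)]
  [∀ y, AddCommGroup (V y)] [∀ y, Module ℝ (V y)] [∀ y, TopologicalSpace (V y)]
  [∀ y, IsTopologicalAddGroup (V y)] [∀ y, ContinuousSMul ℝ (V y)]
  [FiberBundle F V] [VectorBundle ℝ F V] [ContMDiffVectorBundle ∞ F V (𝓡 7)]

theorem trFF_comm (A : CovariantDerivative (𝓡 7) F V) (y₀ : Y) (a b c d : Fin 7) (y : Y) :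
    trFF A y₀ a b c d y = trFF A y₀ c d a b y :=
  Matrix.trace_mul_comm _ _

/-- The trace is linear in its second factor, so the contraction with φ passes onto the matrix
entries of F_cd, where the instanton equation kills it. -/
theorem IsInstanton.sum_trFF_mul_phiUp {S : G2Structure Y} {A : CovariantDerivative (𝓡 7) F V}
    (hA : IsInstanton S A) {y₀ y : Y} (hy : y ∈ patch F V y₀) (a b e : Fin 7) :
    ∑ c, ∑ d, trFF A y₀ a b c d y * S.phiUp y₀ c d e y = 0 := by
  have h : ∀ i j, ∑ c, ∑ d, gaugeCurv A y₀ c d y i j * S.phiUp y₀ c d e y = 0 := fun i j => by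
    have := hA y₀ y hy i j e
    simpa [G2Structure.contract] using this
  calc ∑ c, ∑ d, trFF A y₀ a b c d y * S.phiUp y₀ c d e y
      = ∑ c, ∑ d, ∑ i, ∑ j, gaugeCurv A y₀ a b y i j
          * (gaugeCurv A y₀ c d y j i * S.phiUp y₀ c d e y) := by
        simp only [trFF, Matrix.trace, Matrix.diag, Matrix.mul_apply, Finset.sum_mul, mul_assoc]
    _ = ∑ c, ∑ i, ∑ d, ∑ j, gaugeCurv A y₀ a b y i j
          * (gaugeCurv A y₀ c d y j i * S.phiUp y₀ c d e y) :=
        Finset.sum_congr rfl fun _ _ => Finset.sum_comm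
    _ = ∑ i, ∑ c, ∑ d, ∑ j, gaugeCurv A y₀ a b y i j
          * (gaugeCurv A y₀ c d y j i * S.phiUp y₀ c d e y) := Finset.sum_comm
    _ = ∑ i, ∑ c, ∑ j, ∑ d, gaugeCurv A y₀ a b y i j
          * (gaugeCurv A y₀ c d y j i * S.phiUp y₀ c d e y) :=
        Finset.sum_congr rfl fun _ _ => Finset.sum_congr rfl fun _ _ => Finset.sum_comm
    _ = ∑ i, ∑ j, ∑ c, ∑ d, gaugeCurv A y₀ a b y i j
          * (gaugeCurv A y₀ c d y j i * S.phiUp y₀ c d e y) :=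
        Finset.sum_congr rfl fun _ _ => Finset.sum_comm
    _ = 0 := by simp only [← Finset.mul_sum, h, mul_zero, Finset.sum_const_zero]

/-- The contraction of `tr (F ∧ F)` with `φ` for an instanton. -/
theorem IsInstanton.sum_trFwedgeF_mul_phiUp {S : G2Structure Y}
    {A : CovariantDerivative (𝓡 7) F V} (hA : IsInstanton S A) {y₀ y : Y}
    (hy : y ∈ patch F V y₀) (a b e : Fin 7) :
    ∑ c, ∑ d, trFwedgeF A y₀ a b c d y * S.phiUp y₀ c d e y
      = -4 * ∑ c, ∑ d, trFF A y₀ a c b d y * S.phiUp y₀ c d e y := by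
  have h := hA.sum_trFF_mul_phiUp hy a b e
  have hs : ∑ c, ∑ d, trFF A y₀ a d b c y * S.phiUp y₀ c d e y
      = -∑ c, ∑ d, trFF A y₀ a c b d y * S.phiUp y₀ c d e y := by
    rw [Finset.sum_comm]
    simp only [← Finset.sum_neg_distrib]
    refine Finset.sum_congr rfl fun c _ => Finset.sum_congr rfl fun d _ => ?_
    rw [S.phiUp_swap y₀ d c]
    ring
  -- Cyclicity of the trace pairs the six shuffles into three doubled terms. The first contracts to
  -- zero; the other two agree after contraction because φ^cd_e is skew in c, d, which gives the
  -- factor -4.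
  have hw : ∀ c d, trFwedgeF A y₀ a b c d y * S.phiUp y₀ c d e y
      = 2 * (trFF A y₀ a b c d y * S.phiUp y₀ c d e y)
        - 2 * (trFF A y₀ a c b d y * S.phiUp y₀ c d e y)
        + 2 * (trFF A y₀ a d b c y * S.phiUp y₀ c d e y) := fun c d => by
    rw [trFwedgeF, trFF_comm A y₀ b c a d, trFF_comm A y₀ b d a c, trFF_comm A y₀ c d a b]
    ring
  simp only [hw, Finset.sum_add_distrib, Finset.sum_sub_distrib, ← Finset.mul_sum, h, hs]
  ring

theorem mem_patch_tangent {y₀ y : Y} (hy : y ∈ (chartAt E7 y₀).source) :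
    y ∈ patch E7 (TangentSpace (𝓡 7) : Y → Type) y₀ :=
  ⟨hy, by rwa [tangentTriv_baseSet]⟩

/-- The contraction of the curvature of `θ` with `φ` in a heterotic `G₂` system. -/
theorem IsHeteroticG2System.contract_curvTheta {α' : ℝ} {S : G2Structure Y} {H : ThreeForm Y}
    {cov θt : CovariantDerivative (𝓡 7) E7 (TangentSpace (𝓡 7) : Y → Type)}
    {A : CovariantDerivative (𝓡 7) F V} (h : IsHeteroticG2System α' S H cov A θt)
    {y₀ y : Y} (hy : y ∈ patch F V y₀) (a b e : Fin 7) :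
    S.contract y₀ (fun c d => curvTheta S cov y₀ a b c d y) e y
      = α' / 4 * ∑ c, ∑ d, (trFF A y₀ a c b d y - trFF θt y₀ a c b d y)
        * S.phiUp y₀ c d e y := by
  have h1 := h.connection.sum_curvNabla_mul_phiUp hy.1 a b e
  have h2 := h.instanton_gauge.sum_trFwedgeF_mul_phiUp hy a b e
  have h3 := h.instanton_tangent.sum_trFwedgeF_mul_phiUp (mem_patch_tangent hy.1) a b e
  -- The factor α'/8 is ½ from the term ½ dH times α'/4 from the Bianchi identity.
  have hc : ∀ c d, curvTheta S cov y₀ a b c d y * S.phiUp y₀ c d e y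
      = curvNabla S cov y₀ c d a b y * S.phiUp y₀ c d e y
        - α' / 8 * (trFwedgeF A y₀ a b c d y * S.phiUp y₀ c d e y)
        + α' / 8 * (trFwedgeF θt y₀ a b c d y * S.phiUp y₀ c d e y) := fun c d => by
    have h4 := h.connection.curvNabla_sub_curvTheta hy.1 a b c d
    rw [h.bianchi y₀ y hy] at h4
    linear_combination (-S.phiUp y₀ c d e y) * h4
  simp only [G2Structure.contract, hc, sub_mul, Finset.sum_add_distrib, Finset.sum_sub_distrib,
    ← Finset.mul_sum, h1, h2, h3]
  ring

end Gauge

end Charts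

end HetG2

namespace HetG2

/-! ### Bundles and connections over ℝ⁷, where charts and trivializations are the identity -/

section ModelSpace

variable {F : Type*} [NormedAddCommGroup F] [NormedSpace ℝ F]

theorem mem_tangentTriv_baseSet (y₀ y : E7) : y ∈ (tangentTriv y₀).baseSet := by
  rw [tangentTriv_baseSet]
  exact Set.mem_univ y

theorem tangentTriv_apply_snd (y₀ y v : E7) : (tangentTriv y₀ ⟨y, v⟩).2 = v := by
  simp [tangentTriv, trivializationAt_model_space_apply]

theorem tangentTriv_localFrame {ι : Type*} (b : Module.Basis ι ℝ E7) (i : ι) (y₀ y : E7) :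
    (tangentTriv y₀).localFrame b i y = b i := by
  rw [Trivialization.localFrame_apply_of_mem_baseSet _ _ (mem_tangentTriv_baseSet y₀ y),
    Trivialization.basisAt, Module.Basis.map_apply]
  exact (LinearEquiv.symm_apply_eq _).2 (tangentTriv_apply_snd y₀ y (b i)).symm

theorem tangentTriv_localFrameCoeff {ι : Type*} (b : Module.Basis ι ℝ E7) (i : ι) (y₀ y : E7)
    (v : TangentSpace (𝓡 7) y) :
    (tangentTriv y₀).localFrameCoeff (𝓡 7) b i y v = b.repr v i := by
  have h := (tangentTriv y₀).localFrameCoeff_eq_coeff (I := 𝓡 7) (b := b)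
    (s := fun _ => (show E7 from v)) (mem_tangentTriv_baseSet y₀ y) (i := i)
  rw [tangentTriv_apply_snd] at h
  exact h

theorem trivial_localFrame {ι : Type*} (b : Module.Basis ι ℝ F) (i : ι) (y₀ y : E7) :
    (trivializationAt F (Bundle.Trivial E7 F) y₀).localFrame b i y = b i := by
  have hy : y ∈ (trivializationAt F (Bundle.Trivial E7 F) y₀).baseSet := by simp
  rw [Trivialization.localFrame_apply_of_mem_baseSet _ _ hy, Trivialization.basisAt,
    Module.Basis.map_apply, LinearEquiv.symm_apply_eq]
  rfl

theorem trivial_localFrameCoeff {ι : Type*} (b : Module.Basis ι ℝ F) (i : ι) (y₀ y : E7)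
    (v : F) :
    (trivializationAt F (Bundle.Trivial E7 F) y₀).localFrameCoeff (𝓡 7) b i y v = b.repr v i := by
  have hy : y ∈ (trivializationAt F (Bundle.Trivial E7 F) y₀).baseSet := by simp
  exact (trivializationAt F (Bundle.Trivial E7 F) y₀).localFrameCoeff_eq_coeff (I := 𝓡 7)
    (b := b) (s := fun _ => v) hy (i := i)

theorem contMDiff_trivial_section {s : E7 → F}
    (h : ContMDiff (𝓡 7) ((𝓡 7).prod 𝓘(ℝ, F)) ∞
      (fun y => (⟨y, s y⟩ : TotalSpace F (Bundle.Trivial E7 F)))) : ContDiff ℝ ∞ s :=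
  contMDiff_iff_contDiff.1 fun x => (contMDiffAt_totalSpace.1 (h x)).2

theorem mdifferentiableAt_trivial_section {s : E7 → F} {x : E7}
    (h : MDifferentiableAt (𝓡 7) ((𝓡 7).prod 𝓘(ℝ, F))
      (fun y => (⟨y, s y⟩ : TotalSpace F (Bundle.Trivial E7 F))) x) : DifferentiableAt ℝ s x :=
  mdifferentiableAt_iff_differentiableAt.1 ((mdifferentiableAt_totalSpace _ _).1 h).2

theorem mdifferentiableAt_tangent_section {s : ∀ y : E7, TangentSpace (𝓡 7) y} {x : E7}
    (h : MDifferentiableAt (𝓡 7) ((𝓡 7).prod 𝓘(ℝ, E7))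
      (fun y => (⟨y, s y⟩ : TotalSpace E7 (TangentSpace (𝓡 7) : E7 → Type))) x) :
    DifferentiableAt ℝ (fun y => (show E7 from s y)) x := by
  have h' := ((mdifferentiableAt_totalSpace _ _).1 h).2
  refine mdifferentiableAt_iff_differentiableAt.1
    (h'.congr_of_eventuallyEq (Filter.Eventually.of_forall fun y => ?_))
  exact (tangentTriv_apply_snd x y (s y)).symm

/-- Smoothness of a section is tested in the trivializations of source and target. Over ℝ⁷ both are
the identity, so the coordinate expression is the section itself. -/
theorem contMDiff_hom_trivial_section
    {s : ∀ y : E7, TangentSpace (𝓡 7) y →L[ℝ] Bundle.Trivial E7 F y}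
    (h : ContDiff ℝ ∞ (fun y => (show E7 →L[ℝ] F from s y))) :
    ContMDiff (𝓡 7) ((𝓡 7).prod 𝓘(ℝ, E7 →L[ℝ] F)) ∞
      (fun y => (⟨y, s y⟩ : TotalSpace (E7 →L[ℝ] F)
        fun y : E7 => TangentSpace (𝓡 7) y →L[ℝ] Bundle.Trivial E7 F y)) := by
  intro x
  refine (contMDiffAt_section x).2 ?_
  refine h.contMDiff.contMDiffAt.congr_of_eventuallyEq (Filter.Eventually.of_forall fun y => ?_)
  simp only [hom_trivializationAt_apply]
  ext v
  simp only [ContinuousLinearMap.inCoordinates, ContinuousLinearMap.comp_apply]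
  erw [TangentBundle.symmL_model_space]
  exact DFunLike.congr_fun (Bundle.Trivial.continuousLinearMapAt_trivialization ℝ E7 F y) (s y v)

theorem contMDiff_hom_tangent_section
    {s : ∀ y : E7, TangentSpace (𝓡 7) y →L[ℝ] TangentSpace (𝓡 7) y}
    (h : ContDiff ℝ ∞ (fun y => (show E7 →L[ℝ] E7 from s y))) :
    ContMDiff (𝓡 7) ((𝓡 7).prod 𝓘(ℝ, E7 →L[ℝ] E7)) ∞
      (fun y => (⟨y, s y⟩ : TotalSpace (E7 →L[ℝ] E7)
        fun y : E7 => TangentSpace (𝓡 7) y →L[ℝ] TangentSpace (𝓡 7) y)) := by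
  intro x
  refine (contMDiffAt_section x).2 ?_
  refine h.contMDiff.contMDiffAt.congr_of_eventuallyEq (Filter.Eventually.of_forall fun y => ?_)
  simp only [hom_trivializationAt_apply]
  exact inCoordinates_tangent_bundle_core_model_space (I := 𝓡 7) (I' := 𝓡 7) x y x y (s y)

/-- A metric is a section of a nested Hom bundle whose target is the cotangent bundle, so that
bundle's trivialization must be identified too. -/
theorem cotangent_continuousLinearMapAt (x y : E7) (L : TangentSpace (𝓡 7) y →L[ℝ] ℝ) :
    (trivializationAt (E7 →L[ℝ] ℝ) (fun x : E7 => TangentSpace (𝓡 7) x →L[ℝ] ℝ)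
      x).continuousLinearMapAt ℝ y L = L := by
  rw [Trivialization.continuousLinearMapAt_apply, Trivialization.coe_linearMapAt_of_mem]
  · change ContinuousLinearMap.inCoordinates E7 (TangentSpace (𝓡 7) : E7 → Type) ℝ
      (Bundle.Trivial E7 ℝ) x y x y L = L
    ext v
    simp only [ContinuousLinearMap.inCoordinates, ContinuousLinearMap.comp_apply]
    erw [TangentBundle.symmL_model_space]
    exact DFunLike.congr_fun (Bundle.Trivial.continuousLinearMapAt_trivialization ℝ E7 ℝ y) (L v)
  · rw [hom_trivializationAt_baseSet]
    exact ⟨mem_tangentTriv_baseSet x y, Set.mem_univ y⟩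

theorem contMDiff_bilinear_section
    {s : ∀ y : E7, TangentSpace (𝓡 7) y →L[ℝ] TangentSpace (𝓡 7) y →L[ℝ] ℝ}
    (h : ContDiff ℝ ∞ (fun y => (show E7 →L[ℝ] E7 →L[ℝ] ℝ from s y))) :
    ContMDiff (𝓡 7) ((𝓡 7).prod 𝓘(ℝ, E7 →L[ℝ] E7 →L[ℝ] ℝ)) ∞
      (fun y => (TotalSpace.mk' (E7 →L[ℝ] E7 →L[ℝ] ℝ) y (s y) :
        TotalSpace (E7 →L[ℝ] E7 →L[ℝ] ℝ)
          fun y : E7 => TangentSpace (𝓡 7) y →L[ℝ] TangentSpace (𝓡 7) y →L[ℝ] ℝ)) := by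
  intro x
  refine (contMDiffAt_section x).2 ?_
  refine h.contMDiff.contMDiffAt.congr_of_eventuallyEq (Filter.Eventually.of_forall fun y => ?_)
  simp only [hom_trivializationAt_apply]
  ext v w
  simp only [ContinuousLinearMap.inCoordinates, ContinuousLinearMap.comp_apply]
  erw [TangentBundle.symmL_model_space, cotangent_continuousLinearMapAt x y]
  rfl

theorem pd_model (y₀ : E7) (a : Fin 7) (u : E7 → ℝ) (y : E7) :
    pd y₀ a u y = partialDeriv a u y :=
  rfl

theorem coordField_model (y₀ : E7) (a : Fin 7) (y : E7) :
    coordField y₀ a y = EuclideanSpace.single a (1 : ℝ) := by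
  rw [coordField, tangentTriv_localFrame, OrthonormalBasis.coe_toBasis,
    EuclideanSpace.basisFun_apply]

theorem localConnection_add {G : F →L[ℝ] E7 →L[ℝ] F} {s s' : E7 → F} {x : E7}
    (hs : DifferentiableAt ℝ s x) (hs' : DifferentiableAt ℝ s' x) :
    fderiv ℝ (s + s') x + G ((s + s') x) = fderiv ℝ s x + G (s x) + (fderiv ℝ s' x + G (s' x)) := by
  rw [fderiv_add hs hs', Pi.add_apply, map_add]
  abel

/-- Formulated for plain functions so that the connections on trivial bundles and on the tangent
bundle share the same computation. -/
theorem localConnection_leibniz {G : F →L[ℝ] E7 →L[ℝ] F} {s : E7 → F} {g : E7 → ℝ} {x : E7}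
    {L : E7 →L[ℝ] ℝ} (hs : DifferentiableAt ℝ s x) (hg : HasFDerivAt g L x) :
    fderiv ℝ (g • s) x + G ((g • s) x)
      = g x • (fderiv ℝ s x + G (s x)) + L.smulRight (s x) := by
  rw [(hg.smul hs.hasFDerivAt).fderiv, Pi.smul_apply', map_smul, smul_add]
  abel

theorem hasFDerivAt_mvfderiv {g : E7 → ℝ} {x : E7}
    (hg : MDifferentiableAt (𝓡 7) 𝓘(ℝ) g x) :
    HasFDerivAt g (show E7 →L[ℝ] ℝ from mvfderiv (𝓡 7) g x) x :=
  hasMFDerivAt_iff_hasFDerivAt.1 hg.hasMFDerivAt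

/-- The connection `d + G` on the trivial bundle over `ℝ⁷` with fibre `F`. -/
noncomputable def trivialConnection (G : E7 → F →L[ℝ] E7 →L[ℝ] F) :
    CovariantDerivative (𝓡 7) F (Bundle.Trivial E7 F) where
  toFun s y := (fderiv ℝ (fun z => (show F from s z)) y + G y (s y) : E7 →L[ℝ] F)
  isCovariantDerivativeOnUniv :=
    { add := fun hs hs' _ =>
        localConnection_add (mdifferentiableAt_trivial_section hs) (mdifferentiableAt_trivial_section hs')
      leibniz := fun hs hg _ =>
        localConnection_leibniz (mdifferentiableAt_trivial_section hs) (hasFDerivAt_mvfderiv hg) }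

theorem trivialConnection_contMDiff {G : E7 → F →L[ℝ] E7 →L[ℝ] F} (hG : ContDiff ℝ ∞ G) :
    (trivialConnection G).ContMDiffCovariantDerivative ∞ where
  contMDiff :=
    { contMDiff := fun {s} hs => by
        have h1 : ContDiff ℝ ∞ (fun z => (show F from s z)) :=
          contMDiff_trivial_section (contMDiffOn_univ.1 hs)
        refine contMDiffOn_univ.2 (contMDiff_hom_trivial_section ?_)
        exact (h1.fderiv_right (m := ∞) le_rfl).add (hG.clm_apply h1) }

/-- The connection `d + G` on the tangent bundle of `ℝ⁷`. -/
noncomputable def tangentConnection (G : E7 → E7 →L[ℝ] E7 →L[ℝ] E7) :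
    CovariantDerivative (𝓡 7) E7 (TangentSpace (𝓡 7) : E7 → Type) where
  toFun s y := (fderiv ℝ (fun z => (show E7 from s z)) y + G y (s y) : E7 →L[ℝ] E7)
  isCovariantDerivativeOnUniv :=
    { add := fun hs hs' _ =>
        localConnection_add (mdifferentiableAt_tangent_section hs) (mdifferentiableAt_tangent_section hs')
      leibniz := fun hs hg _ =>
        localConnection_leibniz (mdifferentiableAt_tangent_section hs) (hasFDerivAt_mvfderiv hg) }

theorem tangentConnection_contMDiff {G : E7 → E7 →L[ℝ] E7 →L[ℝ] E7} (hG : ContDiff ℝ ∞ G) :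
    (tangentConnection G).ContMDiffCovariantDerivative ∞ where
  contMDiff :=
    { contMDiff := fun {s} hs => by
        have h1 : ContDiff ℝ ∞ (fun z => (show E7 from s z)) :=
          contMDiff_vectorSpace_iff_contDiff.1 (contMDiffOn_univ.1 hs)
        refine contMDiffOn_univ.2 (contMDiff_hom_tangent_section ?_)
        exact (h1.fderiv_right (m := ∞) le_rfl).add (hG.clm_apply h1) }

/-- Coordinate fields are constant, so only G contributes. Its first argument is the section and its
second the direction, hence the order b, a. -/
theorem symbols_tangentConnection (G : E7 → E7 →L[ℝ] E7 →L[ℝ] E7) (y₀ : E7) (a b c : Fin 7)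
    (y : E7) :
    symbols (tangentConnection G) y₀ a b c y
      = G y (EuclideanSpace.single b 1) (EuclideanSpace.single a 1) c := by
  have h : coordField y₀ b = fun _ : E7 => (EuclideanSpace.single b (1 : ℝ) : E7) :=
    funext fun z => coordField_model y₀ b z
  rw [symbols, tangentTriv_localFrameCoeff]
  change (EuclideanSpace.basisFun (Fin 7) ℝ).toBasis.repr
    (fderiv ℝ (coordField y₀ b : E7 → E7) y (coordField y₀ a y)
      + G y (coordField y₀ b y) (coordField y₀ a y)) c = _
  rw [coordField_model, coordField_model, h]
  simp

theorem gaugeField_trivialConnection [FiniteDimensional ℝ F] (G : E7 → F →L[ℝ] E7 →L[ℝ] F)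
    (y₀ : E7) (a : Fin 7) (i j : Fin (Module.finrank ℝ F)) (y : E7) :
    gaugeField (trivialConnection G) y₀ a i j y
      = (Module.finBasis ℝ F).repr
          (G y (Module.finBasis ℝ F j) (EuclideanSpace.single a 1)) i := by
  have h : frame F (Bundle.Trivial E7 F) y₀ j = fun _ : E7 => Module.finBasis ℝ F j :=
    funext fun z => trivial_localFrame _ _ _ _
  rw [gaugeField, trivial_localFrameCoeff]
  change (Module.finBasis ℝ F).repr
    (fderiv ℝ (frame F (Bundle.Trivial E7 F) y₀ j : E7 → F) y (coordField y₀ a y)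
      + G y (frame F (Bundle.Trivial E7 F) y₀ j y) (coordField y₀ a y)) i = _
  rw [coordField_model, h]
  simp

theorem gaugeField_flat_tangentConnection (y₀ : E7) (a : Fin 7)
    (i j : Fin (Module.finrank ℝ E7)) (y : E7) :
    gaugeField (tangentConnection 0) y₀ a i j y = 0 := by
  have h : frame E7 (TangentSpace (𝓡 7) : E7 → Type) y₀ j
      = fun _ : E7 => Module.finBasis ℝ E7 j :=
    funext fun z => tangentTriv_localFrame _ _ _ _
  rw [gaugeField, tangentTriv_localFrameCoeff]
  change (Module.finBasis ℝ E7).repr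
    (fderiv ℝ (frame E7 (TangentSpace (𝓡 7) : E7 → Type) y₀ j : E7 → E7) y (coordField y₀ a y)
      + 0) i = _
  rw [h, fderiv_fun_const]
  change (Module.finBasis ℝ E7).repr ((0 : E7) + 0) i = 0
  simp

theorem gaugeCurv_flat_tangentConnection (y₀ : E7) (a b : Fin 7) (y : E7) :
    gaugeCurv (tangentConnection 0) y₀ a b y = 0 := by
  ext i j
  have h : ∀ a i j, gaugeField (tangentConnection 0) y₀ a i j = fun _ => 0 := fun a i j =>
    funext fun z => gaugeField_flat_tangentConnection y₀ a i j z
  simp [gaugeCurv, h, pd]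

end ModelSpace

end HetG2

namespace HetG2

/-! ### The Heisenberg example: coframe, symbols and parallel tensors -/

section HeisenbergData

/-- The derivatives `∂_a α_b` of the potential `α = x³ dx⁴ - x⁵ dx⁶`. -/
noncomputable def heisD (a b : Fin 7) : ℝ :=
  (if a = 3 then 1 else 0) * (if b = 4 then 1 else 0)
    - (if a = 5 then 1 else 0) * (if b = 6 then 1 else 0)

/-- The components of the two-form `dα = dx³⁴ - dx⁵⁶`. -/
noncomputable def heisF : Matrix (Fin 7) (Fin 7) ℝ :=
  Matrix.of fun a b => heisD a b - heisD b a

/-- The components of the potential `α = x³ dx⁴ - x⁵ dx⁶`. -/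
noncomputable def heisAlpha (b : Fin 7) (y : E7) : ℝ :=
  ∑ a, heisD a b * y a

/-- The components of the one-form `η = dx⁰ + α`. -/
noncomputable def heisEta (b : Fin 7) (y : E7) : ℝ :=
  (if b = 0 then 1 else 0) + heisAlpha b y

/-- The components of the coframe `η, dx¹, …, dx⁶`. -/
noncomputable def heisFrame (y : E7) : Matrix (Fin 7) (Fin 7) ℝ :=
  Matrix.of fun a i => (if a = i then 1 else 0) + (if i = 0 then heisAlpha a y else 0)

/-- The connection symbols of the skew torsion connection. -/
noncomputable def heisSymbol (a b c : Fin 7) (y : E7) : ℝ :=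
  (if c = 0 then heisD a b - heisEta a y * ∑ i, heisF b i * heisAlpha i y else 0)
    + heisEta a y * heisF b c

theorem heisF_apply (a b : Fin 7) : heisF a b = heisD a b - heisD b a := rfl

theorem heisD_zero_left (b : Fin 7) : heisD 0 b = 0 := by simp [heisD]

theorem heisD_zero_right (a : Fin 7) : heisD a 0 = 0 := by simp [heisD]

theorem heisF_swap (a b : Fin 7) : heisF a b = -heisF b a := by
  rw [heisF_apply, heisF_apply]
  ring

theorem heisF_zero_left (b : Fin 7) : heisF 0 b = 0 := by
  rw [heisF_apply, heisD_zero_left, heisD_zero_right, sub_zero]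

theorem heisF_zero_right (a : Fin 7) : heisF a 0 = 0 := by
  rw [heisF_swap, heisF_zero_left, neg_zero]

theorem heisAlpha_zero (y : E7) : heisAlpha 0 y = 0 := by simp [heisAlpha, heisD_zero_right]

theorem heisFrame_apply (y : E7) (a i : Fin 7) :
    heisFrame y a i = (if a = i then 1 else 0) + (if i = 0 then heisAlpha a y else 0) := rfl

theorem heisFrame_zero_right (y : E7) (a : Fin 7) : heisFrame y a 0 = heisEta a y := by
  simp [heisFrame_apply, heisEta]

theorem contDiff_heisAlpha (b : Fin 7) : ContDiff ℝ ∞ (heisAlpha b) := by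
  unfold heisAlpha
  exact ContDiff.sum fun a _ => contDiff_const.mul (EuclideanSpace.proj (𝕜 := ℝ) a).contDiff

theorem contDiff_heisEta (b : Fin 7) : ContDiff ℝ ∞ (heisEta b) :=
  contDiff_const.add (contDiff_heisAlpha b)

theorem contDiff_heisFrame (a i : Fin 7) : ContDiff ℝ ∞ (fun y => heisFrame y a i) := by
  simp only [heisFrame_apply]
  split_ifs with h h'
  all_goals first
    | exact contDiff_const.add (contDiff_heisAlpha a)
    | exact contDiff_const

theorem contDiff_heisSymbol (a b c : Fin 7) : ContDiff ℝ ∞ (heisSymbol a b c) := by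
  unfold heisSymbol
  refine ContDiff.add ?_ ((contDiff_heisEta a).mul contDiff_const)
  split_ifs
  · exact contDiff_const.sub ((contDiff_heisEta a).mul
      (ContDiff.sum fun i _ => contDiff_const.mul (contDiff_heisAlpha i)))
  · exact contDiff_const

theorem partialDeriv_heisAlpha (a b : Fin 7) (y : E7) :
    partialDeriv a (heisAlpha b) y = heisD a b := by
  have h : heisAlpha b = ⇑(∑ a, heisD a b • (EuclideanSpace.proj a : E7 →L[ℝ] ℝ)) := by
    ext y
    simp [heisAlpha]
  rw [partialDeriv, h, ContinuousLinearMap.fderiv]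
  simp

theorem partialDeriv_heisEta (a b : Fin 7) (y : E7) :
    partialDeriv a (heisEta b) y = heisD a b := by
  rw [← partialDeriv_heisAlpha a b y]
  unfold heisEta
  rw [partialDeriv, partialDeriv, fderiv_const_add]

theorem partialDeriv_heisFrame (a b i : Fin 7) (y : E7) :
    partialDeriv a (fun z => heisFrame z b i) y = if i = 0 then heisD a b else 0 := by
  simp only [heisFrame_apply]
  split_ifs with h h' h'
  all_goals first
    | (rw [partialDeriv, fderiv_const_add]; exact partialDeriv_heisAlpha a b y)
    | simp [partialDeriv]

/-- The coframe matrix differs from the identity only in column 0, while row 0 of f is zero. Thus f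
has the same components in the coordinate and the moving frame. -/
theorem heisFrame_mul_heisF (y : E7) : heisFrame y * heisF = heisF := by
  ext a b
  simp [Matrix.mul_apply, heisFrame_apply, add_mul, Finset.sum_add_distrib, heisF_zero_left]

/-- The coframe matrix is 1 + N, where N has α as column 0 and no other entries. Since α₀ = 0, N² =
0 and 1 - N is the inverse. -/
theorem isUnit_det_heisFrame (y : E7) : IsUnit (heisFrame y).det := by
  refine Matrix.isUnit_det_of_right_inverse
    (B := Matrix.of fun a i => (if a = i then 1 else 0) - (if i = 0 then heisAlpha a y else 0)) ?_
  ext a b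
  simp [Matrix.mul_apply, heisFrame_apply, add_mul, mul_sub, Finset.sum_add_distrib,
    Finset.sum_sub_distrib, heisAlpha_zero, Matrix.one_apply]

theorem heisFrame_inv_mul_heisF (y : E7) : (heisFrame y)⁻¹ * heisF = heisF := by
  conv_lhs => rw [← heisFrame_mul_heisF y]
  rw [← mul_assoc, Matrix.nonsing_inv_mul _ (isUnit_det_heisFrame y), one_mul]

theorem heisF_transpose : heisF.transpose = -heisF := by
  ext a b
  rw [Matrix.transpose_apply, heisF_swap, Matrix.neg_apply]

theorem heisF_mul_inv_transpose (y : E7) :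
    heisF * (heisFrame y)⁻¹.transpose = heisF := by
  have h := congrArg Matrix.transpose (heisFrame_inv_mul_heisF y)
  rw [Matrix.transpose_mul, heisF_transpose, Matrix.neg_mul] at h
  exact neg_injective h

/-- The two-form `dx³⁴ - dx⁵⁶` lies in the Lie algebra of `G₂`. -/
theorem slotAction_heisF : slotAction heisF phi0 = 0 := by
  -- All entries are integers, so the identity is mirrored over ℤ, where its finitely many
  -- components are decidable, and then cast to ℝ.
  let d : Fin 7 → Fin 7 → ℤ := fun a b =>
    (if a = 3 then 1 else 0) * (if b = 4 then 1 else 0)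
      - (if a = 5 then 1 else 0) * (if b = 6 then 1 else 0)
  let f : Fin 7 → Fin 7 → ℤ := fun a b => d a b - d b a
  let t : Fin 7 → Fin 7 → Fin 7 → Fin 7 → Fin 7 → Fin 7 → ℤ := fun i j k a b c =>
    f a i * ((if j = b ∧ k = c then 1 else 0) - (if j = c ∧ k = b then 1 else 0))
      + f a j * ((if i = c ∧ k = b then 1 else 0) - (if i = b ∧ k = c then 1 else 0))
      + f a k * ((if i = b ∧ j = c then 1 else 0) - (if i = c ∧ j = b then 1 else 0))
  let s : Fin 7 → Fin 7 → Fin 7 → ℤ := fun a b c =>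
    t 0 1 2 a b c + t 0 3 4 a b c + t 0 5 6 a b c + t 1 3 5 a b c - t 1 4 6 a b c
      - t 2 3 6 a b c - t 2 4 5 a b c
  have hs : ∀ a b c : Fin 7, s a b c - s b a c + s c a b = 0 := by decide +kernel
  have hc : ∀ a b c : Fin 7, ∑ l, heisF a l * phi0 l b c = (s a b c : ℝ) := by
    intro a b c
    simp only [sum_mul_phi0, sum_mul_elem3, heisF_apply, heisD, s, t, f, d]
    push_cast
    rfl
  have key : ∀ a b c : Fin 7,
      ∑ l, heisF a l * phi0 l b c - ∑ l, heisF b l * phi0 l a c + ∑ l, heisF c l * phi0 l a b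
        = 0 := by
    intro a b c
    rw [hc, hc, hc]
    exact_mod_cast hs a b c
  ext a b c
  rw [slotAction_phi0, key]
  rfl

theorem sum_heisF_mul_phi0 (k : Fin 7) : ∑ i, ∑ j, heisF i j * phi0 i j k = 0 :=
  sum_mul_phi0_eq_zero heisF_swap slotAction_heisF k

theorem slot1_add_left {n : Type*} [Fintype n] (A B : Matrix n n ℝ) (t : n → n → n → ℝ) :
    slot1 (A + B) t = slot1 A t + slot1 B t := by
  ext a b c; simp [slot1, add_mul, Finset.sum_add_distrib]

theorem slot2_add_left {n : Type*} [Fintype n] (A B : Matrix n n ℝ) (t : n → n → n → ℝ) :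
    slot2 (A + B) t = slot2 A t + slot2 B t := by
  ext a b c; simp [slot2, add_mul, Finset.sum_add_distrib]

theorem slot3_add_left {n : Type*} [Fintype n] (A B : Matrix n n ℝ) (t : n → n → n → ℝ) :
    slot3 (A + B) t = slot3 A t + slot3 B t := by
  ext a b c; simp [slot3, add_mul, Finset.sum_add_distrib]

/-- The derivation action by a connection matrix in a moving frame. -/
theorem slotAction_moving_frame {n : Type*} [Fintype n] {M P A B : Matrix n n ℝ}
    {t : n → n → n → ℝ} (hM : M * P = A + B) (hB : P * B = B) (ht : slotAction B t = 0) :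
    slotAction M (slot1 P (slot2 P (slot3 P t)))
      = slot1 A (slot2 P (slot3 P t)) + slot1 P (slot2 A (slot3 P t))
        + slot1 P (slot2 P (slot3 A t)) := by
  -- Since P B = B, the terms containing B are the image under P of the action of B on t, and this
  -- vanishes.
  have h1 : slot1 P (slot2 P (slot3 P (slotAction B t)))
      = slot1 B (slot2 P (slot3 P t)) + slot1 P (slot2 B (slot3 P t))
        + slot1 P (slot2 P (slot3 B t)) := by
    simp only [slotAction, slot1_add, slot2_add, slot3_add, slot3_slot1, slot3_slot2, slot2_slot1,
      slot1_slot1, slot2_slot2, slot3_slot3, hB]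
  have h0 : slot1 P (slot2 P (slot3 P (0 : n → n → n → ℝ))) = 0 := by
    ext a b c
    simp [slot1, slot2, slot3]
  rw [ht, h0] at h1
  simp only [slotAction, slot3_slot1, slot3_slot2, slot2_slot1, slot1_slot1, slot2_slot2,
    slot3_slot3, hM, slot1_add_left, slot2_add_left, slot3_add_left, slot1_add, slot2_add]
  refine Eq.trans ?_ (add_zero _)
  rw [h1]
  abel

/-- The first summand is ∂_a of the coframe matrix; the second is the connection form η ⊗ f in the
moving frame. The frame is thus rotated only by an element of the Lie algebra of G₂, which is why g
and φ are parallel. -/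
theorem heisSymbol_mul_heisFrame (a : Fin 7) (y : E7) :
    (Matrix.of fun p q => heisSymbol a p q y) * heisFrame y
      = (Matrix.of fun b i => if i = 0 then heisD a b else 0) + heisEta a y • heisF := by
  ext b i
  simp only [Matrix.mul_apply, Matrix.of_apply, Matrix.add_apply, Matrix.smul_apply, smul_eq_mul,
    heisSymbol, heisFrame_apply, add_mul, mul_add, Finset.sum_add_distrib, ite_mul, zero_mul,
    mul_ite, mul_one, mul_zero, Finset.sum_ite_eq', Finset.mem_univ, if_true, heisAlpha_zero,
    ite_self, Finset.sum_ite_irrel, Finset.sum_const_zero]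
  split_ifs with h
  · subst h
    simp only [Finset.mul_sum, mul_assoc, add_zero, heisF_zero_right, mul_zero]
    simp
  · simp

/-- The frame form of the metric. -/
theorem heisFrame_mul_transpose (y : E7) (b c : Fin 7) :
    (heisFrame y * (heisFrame y).transpose) b c = ∑ i, heisFrame y b i * heisFrame y c i := rfl

/-- With g = P Pᵀ this follows from the moving-frame form of the symbols. Symmetrizing in b, c
removes f and leaves ∂_a g_bc; antisymmetrizing in a, b gives η ∧ f. Metricity and torsion are both
read off here. -/
theorem sum_metric_mul_heisSymbol (a b c : Fin 7) (y : E7) :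
    ∑ e, (heisFrame y * (heisFrame y).transpose) c e * heisSymbol a b e y
      = heisEta c y * heisD a b + heisEta a y * heisF b c := by
  have h1 : ∑ e, (heisFrame y * (heisFrame y).transpose) c e * heisSymbol a b e y
      = ∑ i, heisFrame y c i
        * ((Matrix.of fun p q => heisSymbol a p q y) * heisFrame y) b i := by
    simp only [Matrix.mul_apply, Matrix.transpose_apply, Matrix.of_apply, Finset.mul_sum,
      Finset.sum_mul]
    rw [Finset.sum_comm]
    exact Finset.sum_congr rfl fun _ _ => Finset.sum_congr rfl fun _ _ => by ring
  rw [h1, heisSymbol_mul_heisFrame]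
  have h2 : ∑ i, heisFrame y c i * heisF b i = heisF b c := by
    have := congrFun (congrFun (heisFrame_mul_heisF y) c) b
    rw [Matrix.mul_apply] at this
    rw [heisF_swap b c, ← this, ← Finset.sum_neg_distrib]
    exact Finset.sum_congr rfl fun i _ => by rw [heisF_swap b i]; ring
  simp only [Matrix.add_apply, Matrix.of_apply, Matrix.smul_apply, smul_eq_mul, mul_add, mul_ite,
    mul_zero, Finset.sum_add_distrib, Finset.sum_ite_eq', Finset.mem_univ, if_true,
    heisFrame_zero_right, mul_left_comm _ (heisEta a y), ← Finset.mul_sum, h2]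

theorem partialDeriv_metric_heis (a b c : Fin 7) (y : E7) :
    partialDeriv a (fun z => (heisFrame z * (heisFrame z).transpose) b c) y
      = heisEta c y * heisD a b + heisEta b y * heisD a c := by
  have hd : ∀ b i, DifferentiableAt ℝ (fun z => heisFrame z b i) y := fun b i =>
    ((contDiff_heisFrame b i).differentiable (by simp)).differentiableAt
  simp only [heisFrame_mul_transpose]
  rw [partialDeriv_sum_mul (fun i => hd b i) (fun i => hd c i)]
  simp only [partialDeriv_heisFrame, ite_mul, mul_ite, zero_mul, mul_zero, Finset.sum_ite_eq',
    Finset.mem_univ, if_true, heisFrame_zero_right]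
  ring

/-- The Leibniz rule applied to the three factors of P gives exactly the terms that
`slotAction_moving_frame` leaves once f annihilates `phi0`. -/
theorem partialDeriv_phi_heis (a b c d : Fin 7) (y : E7) :
    partialDeriv a (fun z => slot1 (heisFrame z) (slot2 (heisFrame z) (slot3 (heisFrame z) phi0))
      b c d) y
      = slotAction (Matrix.of fun p q => heisSymbol a p q y)
          (slot1 (heisFrame y) (slot2 (heisFrame y) (slot3 (heisFrame y) phi0))) b c d := by
  have hd : ∀ b i, DifferentiableAt ℝ (fun z => heisFrame z b i) y := fun b i =>
    ((contDiff_heisFrame b i).differentiable (by simp)).differentiableAt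
  have hB : slotAction (heisEta a y • heisF) phi0 = 0 := by
    have h : slotAction (heisEta a y • heisF) phi0 = heisEta a y • slotAction heisF phi0 := by
      ext i j k
      simp only [slotAction_apply, Matrix.smul_apply, smul_eq_mul, Pi.smul_apply, mul_add,
        Finset.mul_sum, mul_assoc]
    rw [h, slotAction_heisF, smul_zero]
  rw [slotAction_moving_frame (heisSymbol_mul_heisFrame a y)
    (by rw [Matrix.mul_smul, heisFrame_mul_heisF]) hB]
  have e3 : ∀ i j, DifferentiableAt ℝ (fun z => slot3 (heisFrame z) phi0 i j d) y := fun i j =>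
    DifferentiableAt.fun_sum fun e _ => (hd d e).mul_const _
  have e2 : ∀ i, DifferentiableAt ℝ
      (fun z => slot2 (heisFrame z) (slot3 (heisFrame z) phi0) i c d) y := fun i =>
    DifferentiableAt.fun_sum fun e _ => (hd c e).mul (e3 i e)
  have d3 : ∀ i j, partialDeriv a (fun z => slot3 (heisFrame z) phi0 i j d) y
      = slot3 (Matrix.of fun b i => if i = 0 then heisD a b else 0) phi0 i j d := by
    intro i j
    have := partialDeriv_sum_mul (a := a) (fun e => hd d e)
      (k := fun e _ => phi0 i j e) fun e => differentiableAt_const _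
    have hc : ∀ r : ℝ, partialDeriv a (fun _ => r) y = 0 := fun r => by simp [partialDeriv]
    simp only [partialDeriv_heisFrame, hc, mul_zero, Finset.sum_const_zero, add_zero] at this
    exact this
  have d2 : ∀ i, partialDeriv a (fun z => slot2 (heisFrame z) (slot3 (heisFrame z) phi0) i c d) y
      = slot2 (Matrix.of fun b i => if i = 0 then heisD a b else 0)
          (slot3 (heisFrame y) phi0) i c d
        + slot2 (heisFrame y)
          (slot3 (Matrix.of fun b i => if i = 0 then heisD a b else 0) phi0) i c d := by
    intro i
    have := partialDeriv_sum_mul (a := a) (fun e => hd c e)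
      (k := fun e z => slot3 (heisFrame z) phi0 i e d) fun e => e3 i e
    simp only [partialDeriv_heisFrame, d3] at this
    exact this
  have := partialDeriv_sum_mul (a := a) (fun e => hd b e)
    (k := fun e z => slot2 (heisFrame z) (slot3 (heisFrame z) phi0) e c d) fun e => e2 e
  simp only [partialDeriv_heisFrame, d2, mul_add, Finset.sum_add_distrib, ← add_assoc] at this
  exact this

end HeisenbergData

end HetG2

namespace HetG2

theorem contDiff_smul_vector {U W : Type*} [NormedAddCommGroup U] [NormedSpace ℝ U]
    [NormedAddCommGroup W] [NormedSpace ℝ W] {u : U → ℝ} (hu : ContDiff ℝ ∞ u) (w : W) :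
    ContDiff ℝ ∞ (fun y => u y • w) :=
  hu.smul contDiff_const

theorem sum_apply_apply {ι U W : Type*} [Fintype ι] [NormedAddCommGroup U] [NormedSpace ℝ U]
    [NormedAddCommGroup W] [NormedSpace ℝ W] (f : ι → U →L[ℝ] U →L[ℝ] W) (v w : U) :
    (∑ i, f i) v w = ∑ i, f i v w := by
  simp

theorem smul_smulRight_apply_apply {U W : Type*} [NormedAddCommGroup U] [NormedSpace ℝ U]
    [NormedAddCommGroup W] [NormedSpace ℝ W] (r : ℝ) (k l : U →L[ℝ] ℝ) (z : W) (v w : U) :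
    (r • k.smulRight (l.smulRight z)) v w = r • k v • l w • z := rfl

/-! ### The Heisenberg example: `G₂` structure, torsion form and connection -/

section HeisenbergForms

/-- The wedge product of three linear forms. -/
noncomputable def wedgeThree {N : Type*} [AddCommGroup N] [Module ℝ N] [TopologicalSpace N]
    (l : Fin 3 → N →L[ℝ] ℝ) : N [⋀^Fin 3]→L[ℝ] ℝ :=
  { (Matrix.detRowAlternating (R := ℝ) (n := Fin 3)).compLinearMap
      (LinearMap.pi fun p => (l p).toLinearMap) with
    cont := by
      change Continuous fun v : Fin 3 → N => (Matrix.of fun q p => l p (v q)).det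
      exact Continuous.matrix_det (continuous_matrix fun q p =>
        (l p).continuous.comp (continuous_apply q)) }

theorem wedgeThree_apply {N : Type*} [AddCommGroup N] [Module ℝ N] [TopologicalSpace N]
    (l : Fin 3 → N →L[ℝ] ℝ) (v : Fin 3 → N) :
    wedgeThree l v = (Matrix.of fun p q => l p (v q)).det := by
  rw [← Matrix.det_transpose]
  rfl

/-- The coframe `η, dx¹, …, dx⁶` as linear forms. -/
noncomputable def heisCoframe (y : E7) (i : Fin 7) : E7 →L[ℝ] ℝ :=
  ∑ a, heisFrame y a i • (EuclideanSpace.proj a : E7 →L[ℝ] ℝ)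

/-- The dual frame. -/
noncomputable def heisVector (y : E7) (i : Fin 7) : E7 :=
  WithLp.toLp 2 fun a => (heisFrame y)⁻¹ i a

theorem heisCoframe_apply (y : E7) (i : Fin 7) (v : E7) :
    heisCoframe y i v = ∑ a, heisFrame y a i * v a := by
  simp [heisCoframe]

theorem heisCoframe_single (y : E7) (i a : Fin 7) :
    heisCoframe y i (EuclideanSpace.single a 1) = heisFrame y a i := by
  simp [heisCoframe_apply]

theorem heisCoframe_heisVector (y : E7) (i j : Fin 7) :
    heisCoframe y i (heisVector y j) = if j = i then 1 else 0 := by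
  have h := congrFun (congrFun (Matrix.nonsing_inv_mul _ (isUnit_det_heisFrame y)) j) i
  rw [Matrix.mul_apply, Matrix.one_apply] at h
  rw [heisCoframe_apply, ← h]
  exact Finset.sum_congr rfl fun a _ => mul_comm _ _

theorem sum_heisCoframe_smul (y v : E7) : ∑ i, heisCoframe y i v • heisVector y i = v := by
  ext a
  have h : ∀ c, ∑ i, heisFrame y c i * (heisFrame y)⁻¹ i a = if c = a then 1 else 0 := fun c => by
    have h := congrFun (congrFun (Matrix.mul_nonsing_inv _ (isUnit_det_heisFrame y)) c) a
    rwa [Matrix.mul_apply, Matrix.one_apply] at h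
  have h1 : (∑ i, heisCoframe y i v • heisVector y i : E7) a
      = ∑ i, ∑ c, heisFrame y c i * v c * (heisFrame y)⁻¹ i a := by
    simp [heisVector, heisCoframe_apply, Finset.sum_mul]
  rw [h1, Finset.sum_comm]
  calc ∑ c, ∑ i, heisFrame y c i * v c * (heisFrame y)⁻¹ i a
      = ∑ c, v c * ∑ i, heisFrame y c i * (heisFrame y)⁻¹ i a := by
        simp only [Finset.mul_sum]
        exact Finset.sum_congr rfl fun c _ => Finset.sum_congr rfl fun i _ => by ring
    _ = v a := by simp [h]

theorem single_eq_sum_heisVector (y : E7) (a : Fin 7) :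
    (EuclideanSpace.single a (1 : ℝ) : E7) = ∑ i, heisFrame y a i • heisVector y i := by
  rw [← sum_heisCoframe_smul y (EuclideanSpace.single a 1)]
  simp only [heisCoframe_single]

theorem contDiff_heisCoframe (i : Fin 7) : ContDiff ℝ ∞ (fun y => heisCoframe y i) :=
  ContDiff.sum fun a _ => (contDiff_heisFrame a i).smul contDiff_const

/-- The dual frame as a basis. -/
noncomputable def heisBasis (y : E7) : Module.Basis (Fin 7) ℝ E7 :=
  Module.Basis.ofEquivFun
    { toFun := fun v i => heisCoframe y i v
      invFun := fun w => ∑ i, w i • heisVector y i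
      map_add' := fun v w => by ext i; simp
      map_smul' := fun r v => by ext i; simp
      left_inv := sum_heisCoframe_smul y
      right_inv := fun w => by
        ext i
        simp [heisCoframe_heisVector] }

theorem heisBasis_apply (y : E7) (i : Fin 7) : heisBasis y i = heisVector y i := by
  rw [heisBasis, Module.Basis.coe_ofEquivFun]
  change ∑ j, (Pi.single i (1 : ℝ) : Fin 7 → ℝ) j • heisVector y j = _
  simp [Pi.single_apply]

/-- The form `e^{ijk}` of the moving coframe. -/
noncomputable def heisElem (i j k : Fin 7) (y : E7) : E7 [⋀^Fin 3]→L[ℝ] ℝ :=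
  wedgeThree ![heisCoframe y i, heisCoframe y j, heisCoframe y k]

theorem heisElem_heisVector (i j k a b c : Fin 7) (y : E7) :
    heisElem i j k y ![heisVector y a, heisVector y b, heisVector y c] = elem3 i j k a b c := by
  rw [heisElem, wedgeThree_apply, elem3]
  congr 1
  ext p q
  have h : ∀ p, (![heisCoframe y i, heisCoframe y j, heisCoframe y k] : Fin 3 → E7 →L[ℝ] ℝ) p
      = heisCoframe y (![i, j, k] p) := by
    intro p
    fin_cases p <;> rfl
  have h' : ∀ q, (![heisVector y a, heisVector y b, heisVector y c] : Fin 3 → E7) q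
      = heisVector y (![a, b, c] q) := by
    intro q
    fin_cases q <;> rfl
  rw [Matrix.of_apply, Matrix.of_apply, h, h', heisCoframe_heisVector]
  simp only [eq_comm]

theorem heisElem_single (i j k a b c : Fin 7) (y : E7) :
    heisElem i j k y ![EuclideanSpace.single a 1, EuclideanSpace.single b 1,
      EuclideanSpace.single c 1]
      = heisFrame y a i * heisFrame y b j * heisFrame y c k
        - heisFrame y a i * heisFrame y c j * heisFrame y b k
        - heisFrame y b i * heisFrame y a j * heisFrame y c k
        + heisFrame y b i * heisFrame y c j * heisFrame y a k
        + heisFrame y c i * heisFrame y a j * heisFrame y b k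
        - heisFrame y c i * heisFrame y b j * heisFrame y a k := by
  rw [heisElem, wedgeThree_apply, Matrix.det_fin_three]
  simp only [Matrix.of_apply, Matrix.cons_val, heisCoframe_single]

/-- The associative form of the moving coframe. -/
noncomputable def heisPhi (y : E7) : E7 [⋀^Fin 3]→L[ℝ] ℝ :=
  heisElem 0 1 2 y + heisElem 0 3 4 y + heisElem 0 5 6 y + heisElem 1 3 5 y
    - heisElem 1 4 6 y - heisElem 2 3 6 y - heisElem 2 4 5 y

/-- The torsion form `η ∧ (dx³⁴ - dx⁵⁶)`. -/
noncomputable def heisTorsion (y : E7) : E7 [⋀^Fin 3]→L[ℝ] ℝ :=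
  heisElem 0 3 4 y - heisElem 0 5 6 y

theorem heisPhi_heisVector (a b c : Fin 7) (y : E7) :
    heisPhi y ![heisVector y a, heisVector y b, heisVector y c] = phi0 a b c := by
  simp only [heisPhi, phi0, ContinuousAlternatingMap.add_apply,
    ContinuousAlternatingMap.sub_apply, heisElem_heisVector]

theorem heisPhi_single (y : E7) :
    (fun a b c => heisPhi y ![EuclideanSpace.single a 1, EuclideanSpace.single b 1,
      EuclideanSpace.single c 1])
      = slot1 (heisFrame y) (slot2 (heisFrame y) (slot3 (heisFrame y) phi0)) := by
  have h := alternating3_sum (heisPhi y) (heisFrame y) (heisVector y)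
    (fun a => EuclideanSpace.single a 1) (single_eq_sum_heisVector y)
  simpa only [heisPhi_heisVector] using h

theorem heisTorsion_single (a b c : Fin 7) (y : E7) :
    heisTorsion y ![EuclideanSpace.single a 1, EuclideanSpace.single b 1,
      EuclideanSpace.single c 1]
      = heisEta a y * heisF b c + heisEta b y * heisF c a + heisEta c y * heisF a b := by
  -- Only η depends on the point; the remaining coframe elements are coordinate differentials.
  have h : ∀ a i, i ≠ 0 → heisFrame y a i = if a = i then 1 else 0 := fun a i hi => by
    simp [heisFrame_apply, hi]
  rw [heisTorsion, ContinuousAlternatingMap.sub_apply, heisElem_single, heisElem_single]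
  simp only [heisFrame_zero_right, h _ 3 (by decide), h _ 4 (by decide), h _ 5 (by decide),
    h _ 6 (by decide), heisF_apply, heisD]
  ring

theorem contDiff_heisElem (i j k a b c : Fin 7) :
    ContDiff ℝ ∞ (fun y => heisElem i j k y ![EuclideanSpace.single a 1,
      EuclideanSpace.single b 1, EuclideanSpace.single c 1]) := by
  simp only [heisElem_single]
  have h := contDiff_heisFrame
  exact ((((((h a i).mul (h b j)).mul (h c k)).sub (((h a i).mul (h c j)).mul (h b k))).sub
    (((h b i).mul (h a j)).mul (h c k))).add (((h b i).mul (h c j)).mul (h a k))).add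
    (((h c i).mul (h a j)).mul (h b k)) |>.sub (((h c i).mul (h b j)).mul (h a k))

/-- The metric for which the moving frame is orthonormal. -/
noncomputable def heisMetric (y : E7) : E7 →L[ℝ] E7 →L[ℝ] ℝ :=
  ∑ i, (heisCoframe y i).smulRight (heisCoframe y i)

theorem heisMetric_apply (y v w : E7) :
    heisMetric y v w = ∑ i, heisCoframe y i v * heisCoframe y i w := by
  simp [heisMetric]

theorem heisMetric_symm (y v w : E7) : heisMetric y v w = heisMetric y w v := by
  rw [heisMetric_apply, heisMetric_apply]
  exact Finset.sum_congr rfl fun i _ => mul_comm _ _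

theorem contDiff_heisMetric : ContDiff ℝ ∞ heisMetric :=
  ContDiff.sum fun i _ => (contDiff_heisCoframe i).smulRight (contDiff_heisCoframe i)

theorem heisMetric_pos (y v : E7) (hv : v ≠ 0) : 0 < heisMetric y v v := by
  rw [heisMetric_apply]
  refine lt_of_le_of_ne (Finset.sum_nonneg fun i _ => mul_self_nonneg _) fun h => hv ?_
  have h0 := (Finset.sum_eq_zero_iff_of_nonneg fun i _ => mul_self_nonneg (heisCoframe y i v)).1
    h.symm
  rw [← sum_heisCoframe_smul y v]
  exact Finset.sum_eq_zero fun i hi => by rw [mul_self_eq_zero.1 (h0 i hi), zero_smul]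

/-- Each squared coframe component of v is bounded by the metric norm squared, so on the unit ball
the components are at most 1 and the norm is at most the sum of the norms of the frame vectors. -/
theorem heisMetric_bounded (y : E7) :
    Bornology.IsVonNBounded ℝ {v : E7 | heisMetric y v v < 1} := by
  rw [NormedSpace.isVonNBounded_iff, isBounded_iff_forall_norm_le]
  refine ⟨∑ i, ‖heisVector y i‖, fun v hv => ?_⟩
  rw [← sum_heisCoframe_smul y v]
  refine (norm_sum_le _ _).trans (Finset.sum_le_sum fun i hi => ?_)
  rw [norm_smul]
  refine mul_le_of_le_one_left (norm_nonneg _) ?_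
  have h1 : heisCoframe y i v * heisCoframe y i v ≤ heisMetric y v v := by
    rw [heisMetric_apply]
    exact Finset.single_le_sum (f := fun i => heisCoframe y i v * heisCoframe y i v)
      (fun j _ => mul_self_nonneg _) hi
  have h2 : heisMetric y v v < 1 := hv
  exact abs_le_one_iff_mul_self_le_one.2 (h1.trans h2.le)

/-- The `G₂` structure on the product of the five-dimensional Heisenberg group with `ℝ²`. -/
noncomputable def heisG2 : G2Structure E7 where
  phi :=
    { form := fun y => (heisPhi y : E7 [⋀^Fin 3]→L[ℝ] ℝ)
      smooth := fun y₀ a b c => by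
        refine (contMDiff_iff_contDiff.2 ?_).contMDiffOn
        have h : comp3 (fun y => (heisPhi y : E7 [⋀^Fin 3]→L[ℝ] ℝ)) y₀ a b c
            = fun y => heisPhi y ![EuclideanSpace.single a 1, EuclideanSpace.single b 1,
              EuclideanSpace.single c 1] := by
          funext y
          simp only [comp3, coordField_model]
          rfl
        rw [h]
        have e := contDiff_heisElem
        exact ((((((e 0 1 2 a b c).add (e 0 3 4 a b c)).add (e 0 5 6 a b c)).add
          (e 1 3 5 a b c)).sub (e 1 4 6 a b c)).sub (e 2 3 6 a b c)).sub (e 2 4 5 a b c) }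
  g :=
    { inner := fun y => heisMetric y
      symm := fun y v w => heisMetric_symm y v w
      pos := fun y v hv => heisMetric_pos y v hv
      isVonNBounded := fun y => heisMetric_bounded y
      contMDiff := contMDiff_bilinear_section contDiff_heisMetric }
  adapted := fun y => by
    refine ⟨heisBasis y, fun i j => ?_, fun i j k => ?_⟩
    · change heisMetric y (heisBasis y i) (heisBasis y j) = _
      rw [heisBasis_apply, heisBasis_apply, heisMetric_apply]
      simp [heisCoframe_heisVector]
    · change heisPhi y ![heisBasis y i, heisBasis y j, heisBasis y k] = _
      rw [heisBasis_apply, heisBasis_apply, heisBasis_apply, heisPhi_heisVector]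

/-- The torsion three-form on the product of the five-dimensional Heisenberg group with `ℝ²`. -/
noncomputable def heisH : ThreeForm E7 where
  form := fun y => (heisTorsion y : E7 [⋀^Fin 3]→L[ℝ] ℝ)
  smooth := fun y₀ a b c => by
    refine (contMDiff_iff_contDiff.2 ?_).contMDiffOn
    have h : comp3 (fun y => (heisTorsion y : E7 [⋀^Fin 3]→L[ℝ] ℝ)) y₀ a b c
        = fun y => heisTorsion y ![EuclideanSpace.single a 1, EuclideanSpace.single b 1,
          EuclideanSpace.single c 1] := by
      funext y
      simp only [comp3, coordField_model]
      rfl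
    rw [h]
    exact (contDiff_heisElem 0 3 4 a b c).sub (contDiff_heisElem 0 5 6 a b c)

theorem comp3_heisH (y₀ : E7) (a b c : Fin 7) :
    comp3 heisH.form y₀ a b c
      = fun y => heisEta a y * heisF b c + heisEta b y * heisF c a + heisEta c y * heisF a b := by
  funext y
  rw [← heisTorsion_single]
  simp only [comp3, coordField_model]
  rfl

theorem gComp_heisG2 (y₀ : E7) (a b : Fin 7) :
    heisG2.gComp y₀ a b = fun y => (heisFrame y * (heisFrame y).transpose) a b := by
  funext y
  simp only [G2Structure.gComp, coordField_model]
  change heisMetric y _ _ = _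
  simp only [heisMetric_apply, heisCoframe_single, heisFrame_mul_transpose]

theorem phiComp_heisG2 (y₀ : E7) (a b c : Fin 7) :
    heisG2.phiComp y₀ a b c
      = fun y => slot1 (heisFrame y) (slot2 (heisFrame y) (slot3 (heisFrame y) phi0)) a b c := by
  funext y
  rw [← heisPhi_single]
  simp only [G2Structure.phiComp, comp3, coordField_model]
  rfl

/-- The connection form of the skew torsion connection. -/
noncomputable def heisConnectionForm (y : E7) : E7 →L[ℝ] E7 →L[ℝ] E7 :=
  ∑ a, ∑ b, ∑ c, heisSymbol a b c y • (EuclideanSpace.proj b : E7 →L[ℝ] ℝ).smulRight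
    ((EuclideanSpace.proj a : E7 →L[ℝ] ℝ).smulRight (EuclideanSpace.single c (1 : ℝ) : E7))

theorem contDiff_heisConnectionForm : ContDiff ℝ ∞ heisConnectionForm :=
  ContDiff.sum fun a _ => ContDiff.sum fun b _ => ContDiff.sum fun c _ =>
    contDiff_smul_vector (contDiff_heisSymbol a b c) _

theorem heisConnectionForm_single (y : E7) (a b : Fin 7) :
    heisConnectionForm y (EuclideanSpace.single b 1) (EuclideanSpace.single a 1)
      = ∑ c, heisSymbol a b c y • (EuclideanSpace.single c (1 : ℝ) : E7) := by
  have h : ∀ p q : Fin 7, (EuclideanSpace.proj p : E7 →L[ℝ] ℝ) (EuclideanSpace.single q 1)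
      = if p = q then 1 else 0 := fun p q => by simp
  simp only [heisConnectionForm, sum_apply_apply, smul_smulRight_apply_apply, h, ite_smul,
    one_smul, zero_smul, smul_ite, smul_zero, Finset.sum_ite_irrel, Finset.sum_const_zero,
    Finset.sum_ite_eq', Finset.mem_univ, if_true]

theorem symbols_heis (y₀ : E7) (a b c : Fin 7) :
    symbols (tangentConnection heisConnectionForm) y₀ a b c = heisSymbol a b c := by
  funext y
  rw [symbols_tangentConnection]
  rw [heisConnectionForm_single]
  simp [Pi.single_apply]

theorem isSkewG2Connection_heis :
    IsSkewG2Connection heisG2 heisH (tangentConnection heisConnectionForm) where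
  smooth := tangentConnection_contMDiff contDiff_heisConnectionForm
  metric := fun y₀ y _ a b c => by
    rw [pd_model, gComp_heisG2, partialDeriv_metric_heis]
    have h1 := sum_metric_mul_heisSymbol a b c y
    have h2 := sum_metric_mul_heisSymbol a c b y
    have hs : ∀ e, heisG2.gComp y₀ e c y
        = (heisFrame y * (heisFrame y).transpose) c e := fun e => by
      rw [G2Structure.gComp_symm, gComp_heisG2]
    simp only [hs, symbols_heis]
    simp only [gComp_heisG2, mul_comm (heisSymbol _ _ _ _)]
    rw [h1, h2, heisF_swap c b]
    ring
  parallel := fun y₀ y _ a b c d => by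
    rw [pd_model, phiComp_heisG2, partialDeriv_phi_heis, slotAction_apply]
    simp only [symbols_heis, phiComp_heisG2, Matrix.of_apply]
    ring
  torsion := fun y₀ y _ a b c => by
    simp only [symbols_heis, gComp_heisG2, comp3_heisH, mul_sub, Finset.sum_sub_distrib]
    rw [sum_metric_mul_heisSymbol, sum_metric_mul_heisSymbol, heisF_swap c a, heisF_apply a b]
    ring

/-- The two-form `dx³⁴ - dx⁵⁶` is an abelian instanton. -/
theorem contract_heisF (y₀ : E7) (e : Fin 7) (y : E7) :
    ∑ c, ∑ d, heisF c d * heisG2.phiUp y₀ c d e y = 0 := by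
  have hφ : (fun p q r => heisG2.phiComp y₀ p q r y)
      = slot1 (heisFrame y) (slot2 (heisFrame y) (slot3 (heisFrame y) phi0)) := by
    simp only [phiComp_heisG2]
  have hg : (Matrix.of fun p q => heisG2.gComp y₀ p q y)
      = heisFrame y * (heisFrame y).transpose := by
    ext p q
    rw [Matrix.of_apply, gComp_heisG2]
  simp only [G2Structure.phiUp_eq_slots]
  rw [sum_mul_contract (isUnit_det_heisFrame y) hg hφ, heisFrame_inv_mul_heisF,
    heisF_mul_inv_transpose]
  simp only [sum_heisF_mul_phi0, mul_zero, Finset.sum_const_zero]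

/-- The potential α vanishes at the origin, so the moving frame is the coordinate frame there. -/
theorem phiUp_heisG2_origin (y₀ : E7) (c d e : Fin 7) :
    heisG2.phiUp y₀ c d e 0 = phi0 c d e := by
  have hP : heisFrame 0 = 1 := by
    ext a i
    simp [heisFrame_apply, heisAlpha, Matrix.one_apply]
  have hg : (Matrix.of fun p q => heisG2.gComp y₀ p q 0) = 1 := by
    ext p q
    simp [gComp_heisG2, hP]
  rw [G2Structure.phiUp_eq_slots, hg]
  simp only [inv_one, slot1_one, slot2_one, phiComp_heisG2, hP, slot3_one]

/-- Since dη = f has constant coefficients, d(η ∧ f) = f ∧ f. -/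
theorem dThree_heisH (y₀ : E7) (a b c d : Fin 7) (y : E7) :
    dThree y₀ (comp3 heisH.form y₀) a b c d y
      = 2 * (heisF a b * heisF c d - heisF a c * heisF b d + heisF a d * heisF b c) := by
  have h : ∀ p a b c, pd y₀ p (comp3 heisH.form y₀ a b c) y
      = heisD p a * heisF b c + heisD p b * heisF c a + heisD p c * heisF a b := by
    intro p a b c
    have hd : ∀ a (r : ℝ), DifferentiableAt ℝ (fun z => heisEta a z * r) y := fun a r =>
      (((contDiff_heisEta a).differentiable (by simp)).differentiableAt).mul_const r
    have hm : ∀ a (r : ℝ), partialDeriv p (fun z => heisEta a z * r) y = heisD p a * r := by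
      intro a r
      rw [partialDeriv_mul ((contDiff_heisEta a).differentiable (by simp)).differentiableAt
        (differentiableAt_const r), partialDeriv_heisEta]
      simp [partialDeriv]
    rw [pd_model, comp3_heisH, partialDeriv_add ((hd a _).fun_add (hd b _)) (hd c _),
      partialDeriv_add (hd a _) (hd b _), hm, hm, hm]
  simp only [dThree, h, heisF_apply]
  ring

end HeisenbergForms

/-! ### The Heisenberg example: gauge field, Bianchi identity and failure of the instanton equation
-/

section HeisenbergGauge

variable {F : Type*} [NormedAddCommGroup F] [NormedSpace ℝ F]

/-- The gauge potential `α ⊗ M`. -/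
noncomputable def heisGaugeForm (M : F →L[ℝ] F) (y : E7) : F →L[ℝ] E7 →L[ℝ] F :=
  ∑ a, heisAlpha a y •
    (ContinuousLinearMap.smulRightL ℝ E7 F (EuclideanSpace.proj a : E7 →L[ℝ] ℝ)).comp M

theorem contDiff_heisGaugeForm (M : F →L[ℝ] F) : ContDiff ℝ ∞ (heisGaugeForm M) :=
  ContDiff.sum fun a _ => contDiff_smul_vector (contDiff_heisAlpha a) _

variable [FiniteDimensional ℝ F]

theorem gaugeField_heis (M : F →L[ℝ] F) (y₀ : E7) (a : Fin 7)
    (i j : Fin (Module.finrank ℝ F)) :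
    gaugeField (trivialConnection (heisGaugeForm M)) y₀ a i j
      = fun y => heisAlpha a y
        * LinearMap.toMatrix (Module.finBasis ℝ F) (Module.finBasis ℝ F) M.toLinearMap i j := by
  funext y
  rw [gaugeField_trivialConnection]
  simp [heisGaugeForm, LinearMap.toMatrix_apply]

/-- All components of the potential are multiples of one matrix, so A ∧ A vanishes and the curvature
is dα ⊗ M. -/
theorem gaugeCurv_heis (M : F →L[ℝ] F) (y₀ : E7) (a b : Fin 7) (y : E7) :
    gaugeCurv (trivialConnection (heisGaugeForm M)) y₀ a b y
      = heisF a b • LinearMap.toMatrix (Module.finBasis ℝ F) (Module.finBasis ℝ F)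
          M.toLinearMap := by
  ext i j
  have hm : ∀ a b (r : ℝ), partialDeriv a (fun z => heisAlpha b z * r) y = heisD a b * r := by
    intro a b r
    rw [partialDeriv_mul ((contDiff_heisAlpha b).differentiable (by simp)).differentiableAt
      (differentiableAt_const r), partialDeriv_heisAlpha]
    simp [partialDeriv]
  simp only [gaugeCurv, Matrix.of_apply, gaugeField_heis, pd_model, hm, Matrix.smul_apply,
    smul_eq_mul, heisF_apply]
  rw [Finset.sum_eq_zero fun k _ => by ring]
  ring

theorem trFF_heis {M : F →L[ℝ] F} {r : ℝ} (hM : M.comp M = r • ContinuousLinearMap.id ℝ F)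
    (y₀ : E7) (a b c d : Fin 7) (y : E7) :
    trFF (trivialConnection (heisGaugeForm M)) y₀ a b c d y
      = heisF a b * heisF c d * (r * Module.finrank ℝ F) := by
  have h : M.toLinearMap ∘ₗ M.toLinearMap = r • LinearMap.id := by
    ext v
    exact DFunLike.congr_fun hM v
  rw [trFF, gaugeCurv_heis, gaugeCurv_heis, Matrix.smul_mul, Matrix.mul_smul,
    ← LinearMap.toMatrix_comp, h, map_smul, LinearMap.toMatrix_id]
  simp [Matrix.trace_smul, Matrix.trace_one]
  ring

theorem isInstanton_heis (M : F →L[ℝ] F) :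
    IsInstanton heisG2 (trivialConnection (heisGaugeForm M)) := by
  intro y₀ y _ i j e
  have h := contract_heisF y₀ e y
  simp only [G2Structure.contract, gaugeCurv_heis, Matrix.smul_apply, smul_eq_mul]
  simp only [mul_right_comm _ (LinearMap.toMatrix _ _ _ _ _), ← Finset.sum_mul, h]
  ring

theorem isInstanton_flat : IsInstanton heisG2 (tangentConnection 0) := by
  intro y₀ y _ i j e
  simp [G2Structure.contract, gaugeCurv_flat_tangentConnection]

theorem trFF_flat (y₀ : E7) (a b c d : Fin 7) (y : E7) :
    trFF (tangentConnection 0) y₀ a b c d y = 0 := by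
  simp [trFF, gaugeCurv_flat_tangentConnection]

/-- The heterotic `G₂` system on the product of the Heisenberg group with `ℝ²`. -/
theorem isHeteroticG2System_heis {α' r : ℝ} {M : F →L[ℝ] F}
    (hM : M.comp M = r • ContinuousLinearMap.id ℝ F)
    (hr : α' / 4 * (r * Module.finrank ℝ F) = 1) :
    IsHeteroticG2System α' heisG2 heisH (tangentConnection heisConnectionForm)
      (trivialConnection (heisGaugeForm M)) (tangentConnection 0) where
  connection := isSkewG2Connection_heis
  smooth_gauge := trivialConnection_contMDiff (contDiff_heisGaugeForm M)
  smooth_tangent := tangentConnection_contMDiff contDiff_const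
  instanton_gauge := isInstanton_heis M
  instanton_tangent := isInstanton_flat
  bianchi := fun y₀ y _ a b c d => by
    simp only [dThree_heisH, trFwedgeF, trFF_heis hM, trFF_flat]
    linear_combination (-2 * (heisF a b * heisF c d - heisF a c * heisF b d
      + heisF a d * heisF b c)) * hr

theorem not_thetaIsInstanton_heis {α' r : ℝ} {M : F →L[ℝ] F}
    (hM : M.comp M = r • ContinuousLinearMap.id ℝ F)
    (hr : α' / 4 * (r * Module.finrank ℝ F) = 1) :
    ¬ ThetaIsInstanton heisG2 (tangentConnection heisConnectionForm) := by
  intro h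
  -- For indices 3, 5, 1 at the origin the only surviving term is f₃₄ f₅₆ φ₄₆₁ = 1 · (-1) · (-1),
  -- and the normalization `hr` turns the whole right side into 1.
  have h1 := (isHeteroticG2System_heis hM hr).contract_curvTheta (y₀ := 0) (y := 0)
    ⟨Set.mem_univ _, Set.mem_univ _⟩ 3 5 1
  rw [h 0 0 (Set.mem_univ _) 3 5 1] at h1
  simp only [trFF_heis hM, trFF_flat, phiUp_heisG2_origin, sub_zero] at h1
  have h2 : ∀ c d, heisF 3 c * heisF 5 d * (r * Module.finrank ℝ F) * phi0 c d 1
      = if c = 4 then if d = 6 then r * Module.finrank ℝ F else 0 else 0 := by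
    intro c d
    have e3 : heisF 3 c = if c = 4 then 1 else 0 := by simp [heisF_apply, heisD]
    have e5 : heisF 5 d = if d = 6 then -1 else 0 := by
      by_cases hd : d = 6 <;> simp [heisF_apply, heisD, hd]
    rw [e3, e5]
    split_ifs with hc hd
    · subst hc hd
      simp [phi0, elem3_eq]
    all_goals simp
  simp only [h2, Finset.sum_ite_irrel, Finset.sum_const_zero, Finset.sum_ite_eq', Finset.mem_univ, if_true] at h1
  rw [hr] at h1
  exact zero_ne_one h1

end HeisenbergGauge

/-- An endomorphism of the plane whose square is a given multiple of the identity. -/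
theorem exists_comp_self_eq_smul (r : ℝ) :
    ∃ M : EuclideanSpace ℝ (Fin 2) →L[ℝ] EuclideanSpace ℝ (Fin 2),
      M.comp M = r • ContinuousLinearMap.id ℝ (EuclideanSpace ℝ (Fin 2)) := by
  -- This matrix squares to r for either sign of r. A real line would allow only r ≥ 0 and so only
  -- positive α'.
  refine ⟨Matrix.toEuclideanCLM (𝕜 := ℝ) !![0, 1; r, 0], ?_⟩
  have h : (!![0, 1; r, 0] : Matrix (Fin 2) (Fin 2) ℝ) * !![0, 1; r, 0] = r • 1 := by
    ext i j
    fin_cases i <;> fin_cases j <;> simp [Matrix.mul_apply]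
  rw [← ContinuousLinearMap.mul_def, ← map_mul, h, map_smul, map_one]
  rfl

end HetG2

theorem mainTheorem9
    {Y : Type*} [TopologicalSpace Y] [ChartedSpace HetG2.E7 Y] [IsManifold (𝓡 7) ∞ Y]
    {F : Type*} [NormedAddCommGroup F] [NormedSpace ℝ F] [FiniteDimensional ℝ F]
    {V : Y → Type*} [TopologicalSpace (TotalSpace F V)]
    [∀ y, AddCommGroup (V y)] [∀ y, Module ℝ (V y)] [∀ y, TopologicalSpace (V y)]
    [∀ y, IsTopologicalAddGroup (V y)] [∀ y, ContinuousSMul ℝ (V y)]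
    [FiberBundle F V] [VectorBundle ℝ F V]
    [ContMDiffVectorBundle ∞ F V (𝓡 7)]
    (α' : ℝ) (S : HetG2.G2Structure Y) (H : HetG2.ThreeForm Y)
    (cov : CovariantDerivative (𝓡 7) HetG2.E7 (TangentSpace (𝓡 7) : Y → Type))
    (hcov : HetG2.IsSkewG2Connection S H cov) :
    (∀ (y₀ y : Y), y ∈ (chartAt HetG2.E7 y₀).source → ∀ a b c d,
      HetG2.curvNabla S cov y₀ c d a b y - HetG2.curvTheta S cov y₀ a b c d y
        = 1 / 2 * HetG2.dThree y₀ (HetG2.comp3 H.form y₀) a b c d y) ∧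
    (∀ (A : CovariantDerivative (𝓡 7) F V)
      (θt : CovariantDerivative (𝓡 7) HetG2.E7 (TangentSpace (𝓡 7) : Y → Type)),
      HetG2.IsHeteroticG2System α' S H cov A θt →
      ∀ (y₀ y : Y), y ∈ HetG2.patch F V y₀ → ∀ a b e,
        S.contract y₀ (fun c d => HetG2.curvTheta S cov y₀ a b c d y) e y
          = α' / 4 * ∑ c, ∑ d,
              (HetG2.trFF A y₀ a c b d y - HetG2.trFF θt y₀ a c b d y)
                * S.phiUp y₀ c d e y) ∧
    (α' ≠ 0 →
      ∃ (r : ℕ) (S₁ : HetG2.G2Structure HetG2.E7) (H₁ : HetG2.ThreeForm HetG2.E7)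
        (cov₁ : CovariantDerivative (𝓡 7) HetG2.E7 (TangentSpace (𝓡 7) : HetG2.E7 → Type))
        (A₁ : CovariantDerivative (𝓡 7) (EuclideanSpace ℝ (Fin r))
          (Bundle.Trivial HetG2.E7 (EuclideanSpace ℝ (Fin r))))
        (θ₁ : CovariantDerivative (𝓡 7) HetG2.E7 (TangentSpace (𝓡 7) : HetG2.E7 → Type)),
        HetG2.IsHeteroticG2System α' S₁ H₁ cov₁ A₁ θ₁ ∧
          ¬ HetG2.ThetaIsInstanton S₁ cov₁) := by
  refine ⟨fun y₀ y hy a b c d => hcov.curvNabla_sub_curvTheta hy a b c d,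
    fun A θt h y₀ y hy a b e => h.contract_curvTheta hy a b e, fun hα => ?_⟩
  -- With fibre dimension 2, the value r = 2/α' makes (α'/4) tr(M²) equal to 1, so the Bianchi
  -- identity reduces to dH = f ∧ f.
  obtain ⟨M, hM⟩ := HetG2.exists_comp_self_eq_smul (2 / α')
  have hr : α' / 4 * (2 / α' * Module.finrank ℝ (EuclideanSpace ℝ (Fin 2))) = 1 := by
    rw [finrank_euclideanSpace_fin]
    field_simp
    norm_num
  exact ⟨2, HetG2.heisG2, HetG2.heisH, _, _, _, HetG2.isHeteroticG2System_heis hM hr,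
    HetG2.not_thetaIsInstanton_heis hM hr⟩
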